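/- Two parties, Alice and Bob, hold $k$ copies each of unknown pure states $|\psi\rangle$ and $|\phi\rangle$ in $\mathbb{C}^d$, respectively. They run a protocol consisting of finitely many rounds of local quantum operations (measurements with finitely many outcomes on their own registers, including local ancillas and random choices) and unlimited classical communication (LOCC), together with quantum messages, each of which transfers one $q$-dimensional quantum system from one party to the other; at the end they declare a real number, the estimate. **Theorem.** Let $q=\Omega(\log d)$. Then $k=O(\sqrt{d/q})$ copies, LOCC and $O(1)$ quantum messages of dimension $q$ suffice to estimate $|\langle\psi|\phi\rangle|^2$ to constant error with high probability. Precisely: for every $\varepsilon>0$, $\delta>0$ and $c>0$ there are a constant $C>0$ and a number $m\in\mathbb{N}$, depending only on $\varepsilon,\delta,c$, such that for all integers $d,q$ with $2\le q\le d$ and $q\ge c\log d$ there are a nonnegative integer $k\le C\sqrt{d/q}$ and a protocol as above, using $k$ copies of each state and at most $m$ quantum messages of dimension $q$, such that for all unit vectors $|\psi\rangle,|\phi\rangle\in\mathbb{C}^d$ the estimate $r$ that the protocol declares on input $|\psi\rangle^{\otimes k}\otimes|\phi\rangle^{\otimes k}$ satisfies $$\Pr\left[\,\bigl|\,r-|\langle\psi|\phi\rangle|^2\,\bigr|\le\varepsilon\,\right]\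 \ge\ 1-\delta .$$ -/

import Mathlib

open scoped Matrix

/-- Two-party protocols with local operations, unlimited (public) classical communication, and
`q`-dimensional quantum messages, acting on a register of Alice with orthonormal basis `A` and a
register of Bob with orthonormal basis `B`. A protocol is a finite-depth tree, whose nodes are

* `output r`: stop and declare the estimate `r`;
* `alice K hK next`: Alice performs the quantum measurement with Kraus operators `K i`, where
  `∑ i, (K i)ᴴ * K i = 1`, and announces the outcome `i`; the parties continue with `next i`.
  The post-measurement register `A' i` is arbitrary, so that this covers unitaries, adding local
  ancillas (isometries), discarding subsystems, and random choices (`K i = √(p i) • 1`), which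
  become shared randomness by being announced;
* `bob K hK next`: the same with the roles exchanged;
* `sendToBob next`: Alice sends a `q`-dimensional part of her register to Bob;
* `sendToAlice next`: Bob sends a `q`-dimensional part of his register to Alice. -/
inductive Protocol (q : ℕ) : Type → Type → Type 1 where
  | output {A B : Type} [Fintype A] [Fintype B] (r : ℝ) : Protocol q A B
  | alice {A B : Type} [Fintype A] [DecidableEq A] {ι : Type} [Fintype ι] {A' : ι → Type}
      [∀ i, Fintype (A' i)] (K : ∀ i, Matrix (A' i) A ℂ) (hK : ∑ i, (K i)ᴴ * K i = 1)
      (next : ∀ i, Protocol q (A' i) B) : Protocol q A B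
  | bob {A B : Type} [Fintype B] [DecidableEq B] {ι : Type} [Fintype ι] {B' : ι → Type}
      [∀ i, Fintype (B' i)] (K : ∀ i, Matrix (B' i) B ℂ) (hK : ∑ i, (K i)ᴴ * K i = 1)
      (next : ∀ i, Protocol q A (B' i)) : Protocol q A B
  | sendToBob {A B : Type} (next : Protocol q A (B × Fin q)) : Protocol q (A × Fin q) B
  | sendToAlice {A B : Type} (next : Protocol q (A × Fin q) B) : Protocol q A (B × Fin q)

namespace Protocol

/-- The largest number of `q`-dimensional quantum messages sent (in both directions together)
along any branch of the protocol. -/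
def messages {q : ℕ} : {A B : Type} → Protocol q A B → ℕ
  | _, _, output _ => 0
  | _, _, alice _ _ next => Finset.univ.sup fun i => (next i).messages
  | _, _, bob _ _ next => Finset.univ.sup fun i => (next i).messages
  | _, _, sendToBob next => next.messages + 1
  | _, _, sendToAlice next => next.messages + 1

open Classical in
/-- The probability that the protocol, started in the joint pure state `∑ a b, V a b |a⟩|b⟩`,
declares an estimate in the set `S`. The state vector is not renormalized after a measurement, so
its squared norm is the probability of the branch. In terms of the coefficient matrix `V`, the
operator `K ⊗ 1` acts as `K * V` and `1 ⊗ K` acts as `V * Kᵀ`. -/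
noncomputable def prob {q : ℕ} : {A B : Type} → Protocol q A B → Set ℝ → Matrix A B ℂ → ℝ
  | _, _, output r, S, V => if r ∈ S then ∑ a, ∑ b, ‖V a b‖ ^ 2 else 0
  | _, _, alice K _ next, S, V => ∑ i, (next i).prob S (K i * V)
  | _, _, bob K _ next, S, V => ∑ i, (next i).prob S (V * (K i)ᵀ)
  | _, _, sendToBob next, S, V => next.prob S (Matrix.of fun a bx => V (a, bx.2) bx.1)
  | _, _, sendToAlice next, S, V => next.prob S (Matrix.of fun ax b => V ax.1 (b, ax.2))

end Protocol

/-- The vector `|ψ⟩^{⊗ k}` in the standard basis of `(ℂ^d)^{⊗ k}`. -/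
def tensorPower {d : ℕ} (k : ℕ) (ψ : EuclideanSpace ℂ (Fin d)) : (Fin k → Fin d) → ℂ :=
  fun x => ∏ j, ψ (x j)

/-- Coefficients of the joint input state `|ψ⟩^{⊗ k} ⊗ |φ⟩^{⊗ k}`: Alice holds `k` copies of `ψ`,
Bob holds `k` copies of `φ`. -/
def inputState {d : ℕ} (k : ℕ) (ψ φ : EuclideanSpace ℂ (Fin d)) :
    Matrix (Fin k → Fin d) (Fin k → Fin d) ℂ :=
  Matrix.vecMulVec (tensorPower k ψ) (tensorPower k φ)

/-! Let `N ≈ d/q`. Using shared randomness, both parties apply to every copy the same random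
measurement with `N` outcomes and `q`-dimensional post-measurement states. Each Kraus operator `K a`
acts almost like an isometry scaled by `1/√N` on the given states: `N ⟨K a ψ, K a φ⟩` deviates from
`⟨ψ, φ⟩` with second moment at most `1/q`, and the same holds for the pairs `(ψ, ψ)` and `(φ, φ)`
(`sum_norm_sq_blockKraus_overlap_sub_le`). Hence for large `q` the outcomes are nearly uniform, and
equal outcomes leave states with nearly the original overlap.

By the birthday paradox, about `√N` copies on each side produce an outcome common to both parties
(`expect_collisions_sq_le`). Alice sends that one block, and Bob's swap test declares `±1` with mean
close to `|⟨ψ, φ⟩|²` (`exists_round`, `abs_sum_selected_sub_le_of_deviation`). Constantly many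
independent rounds are averaged, and Chebyshev's inequality concludes (`exists_average`).

If `q` is below a constant, the relation `c log d ≤ q` bounds `d`, so a whole copy fits into
constantly many messages (`exists_round_of_le_pow`). -/

open scoped Kronecker

open ComplexConjugate

/-! ### Expectations of estimates, and composition of protocols. -/

namespace Protocol

variable {q : ℕ}

/-- The expectation of `g r`, where `r` is the estimate that the protocol declares when started in
the joint pure state with coefficient matrix `V`. -/
noncomputable def expect : {A B : Type} → Protocol q A B → (ℝ → ℝ) → Matrix A B ℂ → ℝ
  | _, _, output r, g, V => g r * ∑ a, ∑ b, ‖V a b‖ ^ 2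
  | _, _, alice K _ next, g, V => ∑ i, (next i).expect g (K i * V)
  | _, _, bob K _ next, g, V => ∑ i, (next i).expect g (V * (K i)ᵀ)
  | _, _, sendToBob next, g, V => next.expect g (Matrix.of fun a bx => V (a, bx.2) bx.1)
  | _, _, sendToAlice next, g, V => next.expect g (Matrix.of fun ax b => V ax.1 (b, ax.2))

theorem prob_eq_expect {A B : Type} (P : Protocol q A B) (S : Set ℝ) (V : Matrix A B ℂ) :
    P.prob S V = P.expect (S.indicator 1) V := by
  classical
  induction P with
  | output r => simp [prob, expect, Set.indicator_apply]
  | alice K hK next ih => simp [prob, expect, ih]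
  | bob K hK next ih => simp [prob, expect, ih]
  | sendToBob next ih => simp [prob, expect, ih]
  | sendToAlice next ih => simp [prob, expect, ih]

theorem expect_add {A B : Type} (P : Protocol q A B) (g h : ℝ → ℝ) (V : Matrix A B ℂ) :
    P.expect (fun r => g r + h r) V = P.expect g V + P.expect h V := by
  induction P with
  | output r => simp [expect, add_mul]
  | alice K hK next ih => simp [expect, ih, Finset.sum_add_distrib]
  | bob K hK next ih => simp [expect, ih, Finset.sum_add_distrib]
  | sendToBob next ih => simp [expect, ih]
  | sendToAlice next ih => simp [expect, ih]

theorem expect_const_mul {A B : Type} (P : Protocol q A B) (c : ℝ) (g : ℝ → ℝ)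
    (V : Matrix A B ℂ) : P.expect (fun r => c * g r) V = c * P.expect g V := by
  induction P with
  | output r => simp [expect, mul_assoc]
  | alice K hK next ih => simp [expect, ih, Finset.mul_sum]
  | bob K hK next ih => simp [expect, ih, Finset.mul_sum]
  | sendToBob next ih => simp [expect, ih]
  | sendToAlice next ih => simp [expect, ih]

theorem expect_mono {A B : Type} (P : Protocol q A B) {g h : ℝ → ℝ} (hgh : ∀ r, g r ≤ h r)
    (V : Matrix A B ℂ) : P.expect g V ≤ P.expect h V := by
  induction P with
  | output r => exact mul_le_mul_of_nonneg_right (hgh r) (by positivity)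
  | alice K hK next ih => exact Finset.sum_le_sum fun i _ => ih i _
  | bob K hK next ih => exact Finset.sum_le_sum fun i _ => ih i _
  | sendToBob next ih => exact ih _
  | sendToAlice next ih => exact ih _

theorem expect_smul {A B : Type} (P : Protocol q A B) (g : ℝ → ℝ) (c : ℂ) (V : Matrix A B ℂ) :
    P.expect g (c • V) = ‖c‖ ^ 2 * P.expect g V := by
  induction P with
  | output r =>
    simp only [expect, Matrix.smul_apply, smul_eq_mul, norm_mul, mul_pow, ← Finset.mul_sum]
    ring
  | alice K hK next ih => simp [expect, ih, Finset.mul_sum]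
  | bob K hK next ih => simp [expect, ih, Finset.mul_sum]
  | sendToBob next ih => exact ih _
  | sendToAlice next ih => exact ih _

theorem sum_norm_sq_eq_trace {A B : Type} [Fintype A] [Fintype B] (V : Matrix A B ℂ) :
    ((∑ a, ∑ b, ‖V a b‖ ^ 2 : ℝ) : ℂ) = (Vᴴ * V).trace := by
  simp only [Matrix.trace, Matrix.diag, Matrix.mul_apply, Matrix.conjTranspose_apply,
    RCLike.star_def, Complex.conj_mul']
  push_cast
  exact Finset.sum_comm

theorem sum_norm_sq_kraus_mul {A B ι : Type} [Fintype A] [DecidableEq A] [Fintype B] [Fintype ι]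
    {A' : ι → Type} [∀ i, Fintype (A' i)] (K : ∀ i, Matrix (A' i) A ℂ)
    (hK : ∑ i, (K i)ᴴ * K i = 1) (V : Matrix A B ℂ) :
    ∑ i, ∑ a, ∑ b, ‖(K i * V) a b‖ ^ 2 = ∑ a, ∑ b, ‖V a b‖ ^ 2 := by
  have h : ∑ i, ((K i * V)ᴴ * (K i * V)).trace = (Vᴴ * V).trace := by
    rw [← Matrix.trace_sum]
    simp only [Matrix.conjTranspose_mul, Matrix.mul_assoc]
    rw [← Matrix.mul_sum]
    simp only [← Matrix.mul_assoc (K _)ᴴ]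
    rw [← Matrix.sum_mul, hK, Matrix.one_mul]
  simp only [← sum_norm_sq_eq_trace] at h
  exact_mod_cast h

theorem sum_norm_sq_transpose {A B : Type} [Fintype A] [Fintype B] (V : Matrix A B ℂ) :
    ∑ b, ∑ a, ‖Vᵀ b a‖ ^ 2 = ∑ a, ∑ b, ‖V a b‖ ^ 2 := by
  simp only [Matrix.transpose_apply]
  exact Finset.sum_comm

theorem expect_const [NeZero q] {A B : Type} (P : Protocol q A B) [hA : Fintype A]
    [hB : Fintype B] (c : ℝ) (V : Matrix A B ℂ) :
    P.expect (fun _ => c) V = c * ∑ a, ∑ b, ‖V a b‖ ^ 2 := by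
  classical
  induction P generalizing hA hB with
  | @output A B iA iB r =>
    obtain rfl : hA = iA := Subsingleton.elim _ _
    obtain rfl : hB = iB := Subsingleton.elim _ _
    rfl
  | @alice A B iA _ _ _ _ _ K hK next ih =>
    obtain rfl : hA = iA := Subsingleton.elim _ _
    simp only [expect, ih, ← Finset.mul_sum, sum_norm_sq_kraus_mul K hK]
  | @bob A B iB _ _ _ _ _ K hK next ih =>
    obtain rfl : hB = iB := Subsingleton.elim _ _
    simp only [expect, ih, ← Finset.mul_sum]
    congr 1
    rw [← sum_norm_sq_transpose V, ← sum_norm_sq_kraus_mul K hK Vᵀ]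
    refine Finset.sum_congr rfl fun i _ => ?_
    rw [← sum_norm_sq_transpose, Matrix.transpose_mul, Matrix.transpose_transpose]
  | @sendToBob A B next ih =>
    -- Only `A × Fin q` is known to be finite; `A` inherits this because `q ≠ 0`.
    let : Fintype A := Fintype.prodLeft (β := Fin q)
    simp only [expect, ih, Matrix.of_apply]
    congr 1
    rw [show hA = instFintypeProd A (Fin q) from Subsingleton.elim _ _]
    simp only [Fintype.sum_prod_type]
    exact Finset.sum_congr rfl fun a _ => Finset.sum_comm
  | @sendToAlice A B next ih =>
    let : Fintype B := Fintype.prodLeft (β := Fin q)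
    simp only [expect, ih, Matrix.of_apply]
    congr 1
    rw [show hB = instFintypeProd B (Fin q) from Subsingleton.elim _ _]
    simp only [Fintype.sum_prod_type]
    exact Finset.sum_congr rfl fun a _ => Finset.sum_comm

/-- A bijection of bases is a local unitary, hence a one-outcome measurement on each side, free of
quantum messages. -/
theorem exists_relabel {A B A' B' : Type} [Fintype A] [Fintype B] (e : A ≃ A') (e' : B ≃ B')
    (P : Protocol q A' B') :
    ∃ Q : Protocol q A B, Q.messages = P.messages ∧
      ∀ g V, Q.expect g V = P.expect g (V.submatrix e.symm e'.symm) := by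
  classical
  let : Fintype A' := Fintype.ofEquiv A e
  let : Fintype B' := Fintype.ofEquiv B e'
  refine ⟨alice (ι := Unit) (A' := fun _ => A')
    (fun _ => (1 : Matrix A A ℂ).submatrix e.symm id) ?_ fun _ =>
    bob (ι := Unit) (B' := fun _ => B')
      (fun _ => (1 : Matrix B B ℂ).submatrix e'.symm id) ?_ fun _ => P, ?_, fun g V => ?_⟩
  · ext i j
    simp [Matrix.one_apply]
  · ext i j
    simp [Matrix.one_apply]
  · simp [messages]
  · simp only [expect, Finset.univ_unique, Finset.sum_singleton]
    congr 1
    ext i j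
    simp [Matrix.mul_apply, Matrix.one_apply]

/-- Run `P` on one pair of registers and then, depending on its estimate `r`, `f r` on a second
pair. -/
theorem exists_seq [NeZero q] {A B : Type} (P : Protocol q A B) [hA : Fintype A] [hB : Fintype B]
    {A₂ B₂ : Type} [Fintype A₂] [Fintype B₂] (f : ℝ → Protocol q A₂ B₂) (M : ℕ)
    (hM : ∀ r, (f r).messages ≤ M) :
    ∃ Q : Protocol q (A × A₂) (B × B₂), Q.messages ≤ P.messages + M ∧
      ∀ g V W, Q.expect g (V ⊗ₖ W) = P.expect (fun r => (f r).expect g W) V := by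
  classical
  induction P generalizing hA hB with
  | @output A B iA iB r =>
    -- At a leaf the first registers are measured in the standard basis and discarded. The branch
    -- `(a, b)` leaves `V a b • W`, and the weights `‖V a b‖ ^ 2` add up to the probability of the
    -- leaf.
    refine ⟨alice (ι := A) (A' := fun _ => A₂)
      (fun a => (1 : Matrix (A × A₂) (A × A₂) ℂ).submatrix (fun x => (a, x)) id) ?_ fun _ =>
      bob (ι := B) (B' := fun _ => B₂)
        (fun b => (1 : Matrix (B × B₂) (B × B₂) ℂ).submatrix (fun x => (b, x)) id) ?_ fun _ => f r,
      ?_, fun g V W => ?_⟩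
    · ext ⟨i, i'⟩ ⟨j, j'⟩
      simp [Matrix.sum_apply, Matrix.mul_apply, Matrix.one_apply, ite_and]
    · ext ⟨i, i'⟩ ⟨j, j'⟩
      simp [Matrix.sum_apply, Matrix.mul_apply, Matrix.one_apply, ite_and]
    · simpa [messages] using fun _ _ => hM r
    · simp only [expect]
      rw [Finset.mul_sum]
      refine Finset.sum_congr (by congr!) fun a _ => ?_
      rw [Finset.mul_sum]
      refine Finset.sum_congr (by congr!) fun b _ => ?_
      rw [mul_comm, ← expect_smul]
      congr 1
      ext i j
      simp [Matrix.mul_apply, Matrix.one_apply]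
  | @alice A B iA _ ι _ A' _ K hK next ih =>
    obtain rfl : hA = iA := Subsingleton.elim _ _
    choose Q hQ hQ' using fun i => ih i
    refine ⟨alice (A' := fun i => A' i × A₂) (fun i => K i ⊗ₖ (1 : Matrix A₂ A₂ ℂ)) ?_ Q, ?_,
      fun g V W => ?_⟩
    · have : ∑ i, (K i)ᴴ ⊗ₖ (1 : Matrix A₂ A₂ ℂ) * K i ⊗ₖ (1 : Matrix A₂ A₂ ℂ)
          = (∑ i, (K i)ᴴ * K i) ⊗ₖ (1 : Matrix A₂ A₂ ℂ) := by
        simp only [← Matrix.mul_kronecker_mul, Matrix.mul_one]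
        ext ⟨i, i'⟩ ⟨j, j'⟩
        simp [Matrix.sum_apply, Finset.sum_mul]
      simp only [Matrix.conjTranspose_kronecker, Matrix.conjTranspose_one]
      convert this
      rw [hK, Matrix.one_kronecker_one]
    · simp only [messages]
      exact Finset.sup_le fun i _ => (hQ i).trans
        (Nat.add_le_add_right (Finset.le_sup (f := fun i => (next i).messages)
          (Finset.mem_univ i)) M)
    · simp only [expect]
      refine Finset.sum_congr rfl fun i _ => ?_
      rw [← hQ']
      congr 1
      have := Matrix.mul_kronecker_mul (K i) V (1 : Matrix A₂ A₂ ℂ) W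
      rw [Matrix.one_mul] at this
      rw [this]
  | @bob A B iB _ ι _ B' _ K hK next ih =>
    obtain rfl : hB = iB := Subsingleton.elim _ _
    choose Q hQ hQ' using fun i => ih i
    refine ⟨bob (B' := fun i => B' i × B₂) (fun i => K i ⊗ₖ (1 : Matrix B₂ B₂ ℂ)) ?_ Q, ?_,
      fun g V W => ?_⟩
    · have : ∑ i, (K i)ᴴ ⊗ₖ (1 : Matrix B₂ B₂ ℂ) * K i ⊗ₖ (1 : Matrix B₂ B₂ ℂ)
          = (∑ i, (K i)ᴴ * K i) ⊗ₖ (1 : Matrix B₂ B₂ ℂ) := by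
        simp only [← Matrix.mul_kronecker_mul, Matrix.mul_one]
        ext ⟨i, i'⟩ ⟨j, j'⟩
        simp [Matrix.sum_apply, Finset.sum_mul]
      simp only [Matrix.conjTranspose_kronecker, Matrix.conjTranspose_one]
      convert this
      rw [hK, Matrix.one_kronecker_one]
    · simp only [messages]
      exact Finset.sup_le fun i _ => (hQ i).trans
        (Nat.add_le_add_right (Finset.le_sup (f := fun i => (next i).messages)
          (Finset.mem_univ i)) M)
    · simp only [expect]
      refine Finset.sum_congr rfl fun i _ => ?_
      rw [← hQ']
      congr 1
      have := Matrix.mul_kronecker_mul V (K i)ᵀ W (1 : Matrix B₂ B₂ ℂ)ᵀ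
      rw [Matrix.transpose_one, Matrix.mul_one] at this
      rw [this]
      ext ⟨i, i'⟩ ⟨j, j'⟩
      simp [Matrix.mul_apply, Matrix.one_apply, eq_comm]
  | @sendToBob A B next ih =>
    let : Fintype A := Fintype.prodLeft (β := Fin q)
    obtain ⟨Q, hQ, hQ'⟩ := ih
    -- A message must be the last tensor factor, so it is moved past the idle second register before
    -- and after transmission.
    obtain ⟨Q₁, h₁, h₁'⟩ := exists_relabel (Equiv.refl (A × A₂))
      (show (B × B₂) × Fin q ≃ (B × Fin q) × B₂ from
        ⟨fun x => ((x.1.1, x.2), x.1.2), fun x => ((x.1.1, x.2), x.1.2), fun _ => rfl,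
          fun _ => rfl⟩) Q
    obtain ⟨Q₂, h₂, h₂'⟩ := exists_relabel
      (show (A × Fin q) × A₂ ≃ (A × A₂) × Fin q from
        ⟨fun x => ((x.1.1, x.2), x.1.2), fun x => ((x.1.1, x.2), x.1.2), fun _ => rfl,
          fun _ => rfl⟩) (Equiv.refl (B × B₂)) (sendToBob Q₁)
    refine ⟨Q₂, by simp only [messages] at h₂ ⊢; omega, fun g V W => ?_⟩
    rw [h₂']
    simp only [expect, h₁']
    rw [← hQ']
    rfl
  | @sendToAlice A B next ih =>
    let : Fintype B := Fintype.prodLeft (β := Fin q)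
    obtain ⟨Q, hQ, hQ'⟩ := ih
    obtain ⟨Q₁, h₁, h₁'⟩ := exists_relabel
      (show (A × A₂) × Fin q ≃ (A × Fin q) × A₂ from
        ⟨fun x => ((x.1.1, x.2), x.1.2), fun x => ((x.1.1, x.2), x.1.2), fun _ => rfl,
          fun _ => rfl⟩) (Equiv.refl (B × B₂)) Q
    obtain ⟨Q₂, h₂, h₂'⟩ := exists_relabel (Equiv.refl (A × A₂))
      (show (B × Fin q) × B₂ ≃ (B × B₂) × Fin q from
        ⟨fun x => ((x.1.1, x.2), x.1.2), fun x => ((x.1.1, x.2), x.1.2), fun _ => rfl,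
          fun _ => rfl⟩) (sendToAlice Q₁)
    refine ⟨Q₂, by simp only [messages] at h₂ ⊢; omega, fun g V W => ?_⟩
    rw [h₂']
    simp only [expect, h₁']
    rw [← hQ']
    rfl

/-- Alice can send a system of dimension `q ^ t` with `t` messages. -/
theorem exists_send (t : ℕ) {A B : Type} [Fintype A] [Fintype B]
    (P : Protocol q A (B × (Fin t → Fin q))) :
    ∃ Q : Protocol q (A × (Fin t → Fin q)) B, Q.messages = P.messages + t ∧
      ∀ g V, Q.expect g V = P.expect g (Matrix.of fun a bx => V (a, bx.2) bx.1) := by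
  induction t generalizing A B with
  | zero =>
    obtain ⟨Q, hQ, hQ'⟩ := exists_relabel (Equiv.prodUnique A (Fin 0 → Fin q))
      (Equiv.prodUnique B (Fin 0 → Fin q)).symm P
    refine ⟨Q, hQ, fun g V => ?_⟩
    rw [hQ']
    congr 1
    ext a ⟨b, x⟩
    simp [Subsingleton.elim x default]
  | succ t ih =>
    obtain ⟨Q₁, h₁, h₁'⟩ := exists_relabel (Equiv.refl A)
      (show (B × Fin q) × (Fin t → Fin q) ≃ B × (Fin (t + 1) → Fin q) from
        (Equiv.prodAssoc _ _ _).trans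
          (Equiv.prodCongr (Equiv.refl B) (Fin.consEquiv fun _ => Fin q))) P
    obtain ⟨Q₂, h₂, h₂'⟩ := ih Q₁
    obtain ⟨Q₃, h₃, h₃'⟩ := exists_relabel
      (show A × (Fin (t + 1) → Fin q) ≃ (A × (Fin t → Fin q)) × Fin q from
        ((Equiv.prodCongr (Equiv.refl A) (Fin.consEquiv fun _ => Fin q).symm).trans
          (Equiv.prodCongr (Equiv.refl A) (Equiv.prodComm _ _))).trans
            (Equiv.prodAssoc _ _ _).symm) (Equiv.refl B) (sendToBob Q₂)
    refine ⟨Q₃, by simp only [messages] at h₃ ⊢; omega, fun g V => ?_⟩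
    rw [h₃']
    simp only [expect, h₂', h₁']
    congr 1
    ext a ⟨b, x⟩
    simp [Matrix.submatrix, Fin.consEquiv]

/-- Independent repetition: the mean squared deviation of the sum of the estimates. -/
theorem exists_repeat [NeZero q] {A B : Type} [Fintype A] [Fintype B] (P : Protocol q A B)
    (h : ℝ → ℝ) (n : ℕ) (acc : ℝ) :
    ∃ Q : Protocol q (Fin n → A) (Fin n → B), Q.messages ≤ n * P.messages ∧
      ∀ (V : Matrix A B ℂ) (g : ℝ → ℝ) (c : ℝ), (∀ r, g (h r) = (r - c) ^ 2) →
        P.expect (fun _ => 1) V = 1 →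
        Q.expect g (Matrix.of fun x y => ∏ i, V (x i) (y i)) =
          (acc + n * P.expect id V - c) ^ 2
            + n * (P.expect (fun r => r ^ 2) V - P.expect id V ^ 2) := by
  induction n generalizing acc with
  | zero =>
    -- `acc` carries the running sum of the estimates; `h` converts the final sum into the declared
    -- value.
    refine ⟨output (h acc), by simp [messages], fun V g c hg _ => ?_⟩
    simp [expect, hg]
  | succ n ih =>
    choose Q hQ hQ' using ih
    obtain ⟨Q₁, h₁, h₁'⟩ := exists_seq P (fun r => Q (acc + r)) _ fun r => hQ _
    obtain ⟨Q₂, h₂, h₂'⟩ := exists_relabel (Fin.consEquiv fun _ : Fin (n + 1) => A).symm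
      (Fin.consEquiv fun _ : Fin (n + 1) => B).symm Q₁
    refine ⟨Q₂, by rw [h₂]; linarith, fun V g c hg hV => ?_⟩
    have hs : ((Matrix.of fun (x : Fin (n + 1) → A) (y : Fin (n + 1) → B) =>
        ∏ i, V (x i) (y i)).submatrix (Fin.consEquiv fun _ : Fin (n + 1) => A).symm.symm
          (Fin.consEquiv fun _ : Fin (n + 1) => B).symm.symm) =
        V ⊗ₖ (Matrix.of fun (x : Fin n → A) (y : Fin n → B) => ∏ i, V (x i) (y i)) := by
      ext ⟨a, x⟩ ⟨b, y⟩
      simp [Fin.consEquiv, Fin.prod_univ_succ]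
    rw [h₂', hs, h₁']
    simp only [hQ' _ V g c hg hV]
    set μ := P.expect id V with hμ
    set s := P.expect (fun r => r ^ 2) V
    -- Given the first estimate `r`, the remaining mean square is quadratic in `r`, so only the
    -- first two moments of `P` enter.
    have : (fun r : ℝ => (acc + r + n * μ - c) ^ 2 + n * (s - μ ^ 2)) = fun r =>
        r ^ 2 + (2 * (acc + n * μ - c) * id r
          + ((acc + n * μ - c) ^ 2 + n * (s - μ ^ 2)) * 1) := by
      funext r
      simp only [id]
      ring
    rw [this, expect_add, expect_add, expect_const_mul, expect_const_mul _ _ (fun _ => 1), hV]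
    push_cast
    ring

end Protocol

/-! ### Finite tensor products of vectors and matrices. -/

theorem prod_sum_eq_sum_prod {κ X R : Type*} [Fintype κ] [DecidableEq κ] [Fintype X]
    [CommSemiring R] (f : κ → X → R) : ∏ i, ∑ x, f i x = ∑ p : κ → X, ∏ i, f i (p i) := by
  rw [Finset.prod_univ_sum, Fintype.piFinset_univ]

/-- The tensor product of a finite family of matrices. -/
def piTensorMat {κ X D : Type*} [Fintype κ] (M : κ → Matrix X D ℂ) : Matrix (κ → X) (κ → D) ℂ :=
  Matrix.of fun x y => ∏ i, M i (x i) (y i)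

/-- The tensor product of a finite family of vectors. -/
def piTensorVec {κ X : Type*} [Fintype κ] (v : κ → X → ℂ) : (κ → X) → ℂ :=
  fun x => ∏ i, v i (x i)

theorem piTensorMat_mulVec {κ X D : Type*} [Fintype κ] [DecidableEq κ] [Fintype D]
    (M : κ → Matrix X D ℂ) (v : κ → D → ℂ) :
    piTensorMat M *ᵥ piTensorVec v = piTensorVec fun i => M i *ᵥ v i := by
  ext x
  simp only [Matrix.mulVec, dotProduct, piTensorMat, piTensorVec, Matrix.of_apply]
  rw [prod_sum_eq_sum_prod fun i y => M i (x i) y * v i y]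
  simp only [Finset.prod_mul_distrib]

theorem piTensorMat_conjTranspose_mul {κ X D : Type*} [Fintype κ] [DecidableEq κ] [Fintype X]
    (M : κ → Matrix X D ℂ) :
    (piTensorMat M)ᴴ * piTensorMat M = piTensorMat fun i => (M i)ᴴ * M i := by
  ext x y
  simp only [Matrix.mul_apply, Matrix.conjTranspose_apply, piTensorMat, Matrix.of_apply]
  rw [prod_sum_eq_sum_prod fun i z => star (M i z (x i)) * M i z (y i)]
  simp only [Finset.prod_mul_distrib, star_prod]

theorem sum_piTensorMat {κ ι X D : Type*} [Fintype κ] [DecidableEq κ] [Fintype ι]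
    (M : ι → Matrix X D ℂ) :
    ∑ a : κ → ι, piTensorMat (fun i => M (a i)) = piTensorMat fun _ : κ => ∑ j, M j := by
  ext x y
  simp only [piTensorMat, Matrix.sum_apply, Matrix.of_apply]
  rw [prod_sum_eq_sum_prod fun i j => M j (x i) (y i)]

theorem piTensorMat_one {κ X : Type*} [Fintype κ] [DecidableEq κ] [DecidableEq X] :
    piTensorMat (fun _ : κ => (1 : Matrix X X ℂ)) = 1 := by
  ext x y
  simp only [piTensorMat, Matrix.of_apply, Matrix.one_apply, Finset.prod_ite_zero,
    Finset.prod_const_one, Finset.mem_univ, forall_true_left, funext_iff]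

/-- The squared Euclidean norm of a vector. -/
noncomputable def normSqVec {X : Type*} [Fintype X] (v : X → ℂ) : ℝ := ∑ x, ‖v x‖ ^ 2

theorem normSqVec_piTensorVec {κ X : Type*} [Fintype κ] [DecidableEq κ] [Fintype X]
    (v : κ → X → ℂ) : normSqVec (piTensorVec v) = ∏ i, normSqVec (v i) := by
  simp only [normSqVec, piTensorVec, norm_prod]
  rw [prod_sum_eq_sum_prod fun i x => ‖v i x‖ ^ 2]
  simp only [Finset.prod_pow]

theorem piTensorVec_funSplitAt_symm {κ X : Type*} [Fintype κ] [DecidableEq κ]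
    (v : κ → X → ℂ) (i : κ) (x : X × ({j // j ≠ i} → X)) :
    piTensorVec v ((Equiv.funSplitAt i X).symm x) =
      v i x.1 * piTensorVec (fun j : {j // j ≠ i} => v j) x.2 := by
  simp only [piTensorVec]
  rw [Fintype.prod_eq_mul_prod_subtype_ne _ i]
  congr 1
  · simp [Equiv.funSplitAt]
  · refine Finset.prod_congr rfl fun j _ => ?_
    simp [Equiv.funSplitAt, j.2]

/-- For `s = ±1` the summand is a coordinate of the projection of `β ⊗ α` onto the symmetric or
antisymmetric subspace. These are the two outcome probabilities of the swap test. -/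
theorem sum_normSq_symm {X : Type*} [Fintype X] (α β : X → ℂ) (s : ℝ) (hs : s ^ 2 = 1) :
    ∑ x, ∑ y, ‖(2⁻¹ : ℂ) * (β x * α y + s * (β y * α x))‖ ^ 2 =
      (normSqVec α * normSqVec β + s * ‖star α ⬝ᵥ β‖ ^ 2) / 2 := by
  have key : (∑ x, ∑ y, ((‖(2⁻¹ : ℂ) * (β x * α y + s * (β y * α x))‖ : ℂ)) ^ 2) =
      (((∑ x, (‖α x‖ : ℂ) ^ 2) * ∑ x, (‖β x‖ : ℂ) ^ 2) + s * (‖star α ⬝ᵥ β‖ : ℂ) ^ 2) / 2 := by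
    simp only [← Complex.conj_mul', map_mul, map_add, dotProduct, Complex.conj_ofReal,
      map_inv₀, map_ofNat, map_sum, Pi.star_apply, RCLike.star_def, Complex.conj_conj]
    have h1 : ∀ x y, 2⁻¹ * ((starRingEnd ℂ) (β x) * (starRingEnd ℂ) (α y)
        + s * ((starRingEnd ℂ) (β y) * (starRingEnd ℂ) (α x)))
        * (2⁻¹ * (β x * α y + s * (β y * α x))) =
        4⁻¹ * (((starRingEnd ℂ) (α y) * α y) * ((starRingEnd ℂ) (β x) * β x))
        + 4⁻¹ * s ^ 2 * (((starRingEnd ℂ) (α x) * α x) * ((starRingEnd ℂ) (β y) * β y))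
        + 4⁻¹ * s * ((α x * (starRingEnd ℂ) (β x)) * ((starRingEnd ℂ) (α y) * β y))
        + 4⁻¹ * s * ((α y * (starRingEnd ℂ) (β y)) * ((starRingEnd ℂ) (α x) * β x)) := by
      intro x y; ring
    have hs' : (s : ℂ) ^ 2 = 1 := by exact_mod_cast hs
    simp only [h1, Finset.sum_add_distrib, ← Finset.mul_sum, ← Finset.sum_mul, hs']
    ring
  apply Complex.ofReal_injective
  simp only [normSqVec]
  push_cast
  rw [key]

/-! ### The swap test and a single round. -/

namespace Protocol

variable {q : ℕ}

/-- Bob can perform the swap test on two systems that he holds. -/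
theorem exists_swapTest {A R X : Type} [Fintype A] [Fintype R] [Fintype X] :
    ∃ Q : Protocol q A (R × X × X), Q.messages = 0 ∧
      ∀ (g : ℝ → ℝ) (ξ : A → ℂ) (ρ : R → ℂ) (α β : X → ℂ),
        Q.expect g (Matrix.of fun a r => ξ a * ρ r.1 * (β r.2.1 * α r.2.2)) =
          normSqVec ξ * normSqVec ρ *
            (g 1 * ((normSqVec α * normSqVec β + ‖star α ⬝ᵥ β‖ ^ 2) / 2) +
              g (-1) * ((normSqVec α * normSqVec β - ‖star α ⬝ᵥ β‖ ^ 2) / 2)) := by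
  classical
  -- `S` swaps the two copies of `X`. The Kraus operators `(1 ± S) / 2` are projections, and
  -- declaring the eigenvalue `±1` makes the mean the squared overlap.
  let S : Matrix (R × X × X) (R × X × X) ℂ :=
    (1 : Matrix (R × X × X) (R × X × X) ℂ).submatrix (fun r => (r.1, r.2.2, r.2.1)) id
  let s : Bool → ℝ := fun b => if b then 1 else -1
  have hS : Sᴴ = S := by
    ext ⟨r, x, y⟩ ⟨r', x', y'⟩
    simp only [S, Matrix.conjTranspose_apply, Matrix.submatrix_apply, Matrix.one_apply, id,
      Prod.mk.injEq, apply_ite star, star_one, star_zero]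
    congr 1
    apply propext
    constructor <;> rintro ⟨rfl, rfl, rfl⟩ <;> simp
  have hSS : S * S = 1 := by
    have h : ∀ T : Matrix (R × X × X) (R × X × X) ℂ,
        S * T = T.submatrix (fun r => (r.1, r.2.2, r.2.1)) id := by
      intro T
      ext i j
      simp [S, Matrix.mul_apply, Matrix.one_apply]
    rw [h]
    rfl
  refine ⟨bob (ι := Bool) (B' := fun _ => R × X × X)
    (fun b => (2⁻¹ : ℂ) • (1 + (s b : ℂ) • S)) ?_ fun b => output (s b), ?_,
    fun g ξ ρ α β => ?_⟩
  · have h1 : ∀ b, ((2⁻¹ : ℂ) • (1 + (s b : ℂ) • S))ᴴ * ((2⁻¹ : ℂ) • (1 + (s b : ℂ) • S)) =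
        (2⁻¹ : ℂ) • (1 + (s b : ℂ) • S) := by
      intro b
      have hsb : (s b : ℂ) * s b = 1 := by cases b <;> simp [s]
      simp only [Matrix.conjTranspose_smul, Matrix.conjTranspose_add, Matrix.conjTranspose_one,
        hS, Matrix.smul_mul, Matrix.mul_smul, Matrix.add_mul, Matrix.mul_add, Matrix.one_mul,
        Matrix.mul_one, hSS, smul_smul, smul_add, RCLike.star_def, map_mul,
        Complex.conj_ofReal, map_inv₀, map_ofNat]
      ext i j
      simp only [Matrix.add_apply, Matrix.smul_apply, smul_eq_mul]
      linear_combination (4⁻¹ * (1 : Matrix _ _ ℂ) i j) * hsb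
    simp only [h1, Fintype.sum_bool, s]
    ext i j
    simp
    ring
  · simp [messages]
  · set V : Matrix A (R × X × X) ℂ :=
      Matrix.of fun a r => ξ a * ρ r.1 * (β r.2.1 * α r.2.2) with hV
    have h2 : ∀ b, ∑ a, ∑ r, ‖(V * ((2⁻¹ : ℂ) • (1 + (s b : ℂ) • S))ᵀ : Matrix A (R × X × X) ℂ) a r‖ ^ 2 =
        normSqVec ξ * normSqVec ρ *
          ((normSqVec α * normSqVec β + s b * ‖star α ⬝ᵥ β‖ ^ 2) / 2) := by
      intro b
      have h3 : ∀ a r, (V * ((2⁻¹ : ℂ) • (1 + (s b : ℂ) • S))ᵀ : Matrix A (R × X × X) ℂ) a r =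
          ξ a * ρ r.1 * ((2⁻¹ : ℂ) * (β r.2.1 * α r.2.2 + s b * (β r.2.2 * α r.2.1))) := by
        intro a r
        have h4 : (V * Sᵀ : Matrix A (R × X × X) ℂ) a r = ξ a * ρ r.1 * (β r.2.2 * α r.2.1) := by
          simp [hV, S, Matrix.mul_apply, Matrix.one_apply]
        rw [Matrix.transpose_smul, Matrix.transpose_add, Matrix.transpose_smul,
          Matrix.transpose_one, Matrix.mul_smul, Matrix.mul_add, Matrix.mul_smul, Matrix.mul_one]
        simp only [Matrix.smul_apply, Matrix.add_apply, h4, smul_eq_mul]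
        simp only [hV, Matrix.of_apply]
        ring
      simp only [h3, norm_mul (ξ _ * ρ _), norm_mul (ξ _), mul_pow, Fintype.sum_prod_type,
        ← Finset.mul_sum, ← Finset.sum_mul]
      rw [sum_normSq_symm α β (s b) (by cases b <;> simp [s])]
      rfl
    simp only [expect, h2, Fintype.sum_bool, s]
    simp
    ring

/-- Alice sends the `i`-th of her systems and Bob performs the swap test on it and the `j`-th of
his systems. -/
theorem exists_swapTest_at {κ X : Type} [Fintype κ] [DecidableEq κ] [Fintype X] {t : ℕ}
    (e : X ≃ (Fin t → Fin q)) (i j : κ) :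
    ∃ Q : Protocol q (κ → X) (κ → X), Q.messages = t ∧
      ∀ (g : ℝ → ℝ) (α β : κ → X → ℂ),
        Q.expect g (Matrix.vecMulVec (piTensorVec α) (piTensorVec β)) =
          (∏ l : {l // l ≠ i}, normSqVec (α l)) * (∏ l : {l // l ≠ j}, normSqVec (β l)) *
            (g 1 * ((normSqVec (α i) * normSqVec (β j) + ‖star (α i) ⬝ᵥ β j‖ ^ 2) / 2) +
              g (-1) * ((normSqVec (α i) * normSqVec (β j) - ‖star (α i) ⬝ᵥ β j‖ ^ 2) / 2)) := by
  obtain ⟨Q₀, h₀, h₀'⟩ := exists_swapTest (q := q) (A := {l // l ≠ i} → X)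
    (R := {l // l ≠ j} → X) (X := X)
  obtain ⟨Q₁, h₁, h₁'⟩ := exists_relabel (Equiv.refl ({l // l ≠ i} → X))
    (show (κ → X) × (Fin t → Fin q) ≃ ({l // l ≠ j} → X) × X × X from
      (Equiv.prodCongr ((Equiv.funSplitAt j X).trans (Equiv.prodComm _ _)) e.symm).trans
        (Equiv.prodAssoc _ _ _)) Q₀
  obtain ⟨Q₂, h₂, h₂'⟩ := exists_send t Q₁
  obtain ⟨Q₃, h₃, h₃'⟩ := exists_relabel
    (show (κ → X) ≃ ({l // l ≠ i} → X) × (Fin t → Fin q) from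
      ((Equiv.funSplitAt i X).trans (Equiv.prodComm _ _)).trans
        (Equiv.prodCongr (Equiv.refl _) e)) (Equiv.refl (κ → X)) Q₂
  refine ⟨Q₃, by omega, fun g α β => ?_⟩
  rw [h₃', h₂', h₁', ← normSqVec_piTensorVec, ← normSqVec_piTensorVec, ← h₀']
  congr 1
  ext a ⟨r, x, y⟩
  simp [Matrix.vecMulVec_apply, piTensorVec_funSplitAt_symm]
  ring

/-- The round: with shared randomness `u`, both parties measure all their copies with the Kraus
operators `M u`, and perform a swap test on the pair of copies that `sel` chooses. -/
theorem exists_round {d k t : ℕ} {Ω ι X : Type} [Fintype Ω] [Nonempty Ω] [Fintype ι] [Fintype X]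
    (e : X ≃ (Fin t → Fin q)) (M : Ω → ι → Matrix X (Fin d) ℂ)
    (hM : ∀ u, ∑ a, (M u a)ᴴ * M u a = 1)
    (sel : (Fin k → ι) → (Fin k → ι) → Fin k × Fin k) :
    ∃ Q : Protocol q (Fin k → Fin d) (Fin k → Fin d), Q.messages ≤ t ∧
      ∀ ψ φ : EuclideanSpace ℂ (Fin d),
        Q.expect (fun r => r ^ 2) (inputState k ψ φ) = Q.expect (fun _ => 1) (inputState k ψ φ) ∧
        Q.expect id (inputState k ψ φ) = (Fintype.card Ω : ℝ)⁻¹ * ∑ u, ∑ a, ∑ b,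
          (∏ l : {l // l ≠ (sel a b).1}, normSqVec (M u (a l) *ᵥ ψ)) *
          (∏ l : {l // l ≠ (sel a b).2}, normSqVec (M u (b l) *ᵥ φ)) *
          ‖star (M u (a (sel a b).1) *ᵥ ψ) ⬝ᵥ (M u (b (sel a b).2) *ᵥ φ)‖ ^ 2 := by
  classical
  choose Q₀ h₀ h₀' using fun i j : Fin k => exists_swapTest_at (q := q) e i j
  -- Alice draws `u` uniformly by absorbing the amplitude `c` into her Kraus operators; announcing
  -- the outcome makes `u` shared.
  set c : ℂ := (((√(Fintype.card Ω : ℝ))⁻¹ : ℝ) : ℂ) with hc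
  have hcard : (0 : ℝ) < Fintype.card Ω := by exact_mod_cast Fintype.card_pos
  have hcn : ‖c‖ ^ 2 = (Fintype.card Ω : ℝ)⁻¹ := by
    rw [hc, Complex.norm_real, Real.norm_eq_abs, sq_abs, inv_pow, Real.sq_sqrt hcard.le]
  have hcc : c * star c = (Fintype.card Ω : ℂ)⁻¹ := by
    rw [RCLike.star_def, Complex.mul_conj', ← Complex.ofReal_pow, hcn]
    simp
  have hsum : ∀ u, ∑ a : Fin k → ι, (piTensorMat fun i => M u (a i))ᴴ *
      (piTensorMat fun i => M u (a i)) = 1 := by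
    intro u
    simp only [piTensorMat_conjTranspose_mul]
    rw [sum_piTensorMat fun j => (M u j)ᴴ * M u j, hM, piTensorMat_one]
  let Q : Protocol q (Fin k → Fin d) (Fin k → Fin d) :=
    alice (ι := Ω × (Fin k → ι)) (A' := fun _ => Fin k → X)
      (fun ua => c • piTensorMat fun i => M ua.1 (ua.2 i))
      (by
        simp only [Matrix.conjTranspose_smul, Matrix.smul_mul, Matrix.mul_smul, smul_smul, hcc,
          Fintype.sum_prod_type, ← Finset.smul_sum, hsum]
        rw [Finset.sum_const, Finset.card_univ, ← Nat.cast_smul_eq_nsmul ℂ, smul_smul,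
          inv_mul_cancel₀ (by exact_mod_cast hcard.ne'), one_smul]) fun ua =>
      bob (ι := Fin k → ι) (B' := fun _ => Fin k → X)
        (fun b => piTensorMat fun i => M ua.1 (b i)) (by convert hsum ua.1) fun b =>
        Q₀ (sel ua.2 b).1 (sel ua.2 b).2
  have hQ : ∀ g (ψ φ : EuclideanSpace ℂ (Fin d)), Q.expect g (inputState k ψ φ) =
      ∑ u, ∑ a, ∑ b, (Fintype.card Ω : ℝ)⁻¹ *
        (Q₀ (sel a b).1 (sel a b).2).expect g
          (Matrix.vecMulVec (piTensorVec fun i => M u (a i) *ᵥ ψ)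
            (piTensorVec fun i => M u (b i) *ᵥ φ)) := by
    intro g ψ φ
    simp only [Q, expect, Fintype.sum_prod_type, ← hcn, ← expect_smul]
    refine Finset.sum_congr rfl fun u _ => Finset.sum_congr rfl fun a _ =>
      Finset.sum_congr rfl fun b _ => ?_
    congr 1
    change (c • piTensorMat _) * Matrix.vecMulVec (piTensorVec fun _ => ⇑ψ)
      (piTensorVec fun _ => ⇑φ) * _ = _
    rw [Matrix.mul_vecMulVec, Matrix.vecMulVec_mul, Matrix.vecMul_transpose, Matrix.smul_mulVec,
      piTensorMat_mulVec, piTensorMat_mulVec, Matrix.smul_vecMulVec]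
  refine ⟨Q, ?_, fun ψ φ => ⟨?_, ?_⟩⟩
  · simp only [Q, messages, h₀]
    exact Finset.sup_le fun _ _ => Finset.sup_le fun _ _ => le_rfl
  -- Every leaf declares `1` or `-1`, where `r ^ 2` equals `1`.
  · rw [hQ, hQ]
    simp only [h₀']
    norm_num
  · rw [hQ]
    simp only [h₀', Finset.mul_sum]
    refine Finset.sum_congr rfl fun u _ => Finset.sum_congr rfl fun a _ =>
      Finset.sum_congr rfl fun b _ => ?_
    simp only [id]
    ring

end Protocol

/-! ### Moments of sums of independent variables. -/

theorem sum_cons_eq {ι : Type*} [Fintype ι] {n : ℕ} (f : (Fin (n + 1) → ι) → ℝ) :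
    ∑ x, f x = ∑ a, ∑ x, f (Fin.cons a x) := by
  rw [← (Fin.consEquiv fun _ : Fin (n + 1) => ι).sum_comp, Fintype.sum_prod_type]
  rfl

section ProductWeights

variable {ι : Type*} [Fintype ι] {w : ι → ℝ}

theorem sum_prodWeight (hw : ∑ a, w a = 1) (n : ℕ) : ∑ x : Fin n → ι, ∏ i, w (x i) = 1 := by
  rw [← prod_sum_eq_sum_prod fun _ : Fin n => w]
  simp [hw]

theorem sum_prodWeight_mul_sum (hw : ∑ a, w a = 1) (f : ι → ℝ) (n : ℕ) :
    ∑ x : Fin n → ι, (∏ i, w (x i)) * ∑ i, f (x i) = n * ∑ a, w a * f a := by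
  induction n with
  | zero => simp
  | succ n ih =>
    rw [sum_cons_eq]
    have : ∀ a, ∑ x : Fin n → ι, (∏ i, w (Fin.cons (α := fun _ => ι) a x i)) *
        ∑ i, f (Fin.cons (α := fun _ => ι) a x i) =
        w a * f a + w a * (n * ∑ a, w a * f a) := by
      intro a
      rw [← ih, Finset.mul_sum, ← mul_one (w a * f a), ← sum_prodWeight hw n, Finset.mul_sum,
        ← Finset.sum_add_distrib]
      refine Finset.sum_congr rfl fun x _ => ?_
      simp only [Fin.prod_univ_succ, Fin.sum_univ_succ, Fin.cons_zero, Fin.cons_succ]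
      ring
    simp only [this, Finset.sum_add_distrib, ← Finset.sum_mul, hw]
    push_cast
    ring

/-- Squared bias plus variance: under the product weight the terms `f (x i)` are independent and
identically distributed. -/
theorem sum_prodWeight_mul_sq (hw : ∑ a, w a = 1) (f : ι → ℝ) (n : ℕ) (c : ℝ) :
    ∑ x : Fin n → ι, (∏ i, w (x i)) * (∑ i, f (x i) - c) ^ 2 =
      (n * ∑ a, w a * f a - c) ^ 2 + n * (∑ a, w a * f a ^ 2 - (∑ a, w a * f a) ^ 2) := by
  induction n generalizing c with
  | zero => simp
  | succ n ih =>
    rw [sum_cons_eq]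
    set m := ∑ a, w a * f a with hm
    set s := ∑ a, w a * f a ^ 2 with hs
    have : ∀ a, ∑ x : Fin n → ι, (∏ i, w (Fin.cons (α := fun _ => ι) a x i)) *
        (∑ i, f (Fin.cons (α := fun _ => ι) a x i) - c) ^ 2 =
        w a * f a ^ 2 + 2 * (n * m - c) * (w a * f a)
          + ((n * m - c) ^ 2 + n * (s - m ^ 2)) * w a := by
      intro a
      have h : w a * ((n * m - (c - f a)) ^ 2 + n * (s - m ^ 2)) =
          w a * f a ^ 2 + 2 * (n * m - c) * (w a * f a)
          + ((n * m - c) ^ 2 + n * (s - m ^ 2)) * w a := by ring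
      rw [← h, ← ih, Finset.mul_sum]
      refine Finset.sum_congr rfl fun x _ => ?_
      simp only [Fin.prod_univ_succ, Fin.sum_univ_succ, Fin.cons_zero, Fin.cons_succ]
      ring
    simp only [this, Finset.sum_add_distrib, ← Finset.mul_sum, hw, ← hm, ← hs]
    push_cast
    ring

end ProductWeights

/-! ### The birthday paradox for two samples. -/

section Collisions

variable {ι : Type*} [DecidableEq ι] {k : ℕ}

/-- The number of pairs `(i, j)` with `a i = b j ∈ G`. -/
def collisions (G : Finset ι) (a b : Fin k → ι) : ℝ :=
  ∑ i, ∑ j, if a i = b j ∧ a i ∈ G then 1 else 0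

theorem collisions_nonneg (G : Finset ι) (a b : Fin k → ι) : 0 ≤ collisions G a b :=
  Finset.sum_nonneg fun _ _ => Finset.sum_nonneg fun _ _ => by split_ifs <;> norm_num

theorem one_le_collisions {G : Finset ι} {a b : Fin k → ι} {i j : Fin k} (h : a i = b j)
    (hG : a i ∈ G) : 1 ≤ collisions G a b := by
  have h0 : ∀ i j, (0 : ℝ) ≤ if a i = b j ∧ a i ∈ G then 1 else 0 := fun i j => by
    split_ifs <;> norm_num
  calc (1 : ℝ) = if a i = b j ∧ a i ∈ G then 1 else 0 := by rw [if_pos ⟨h, hG⟩]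
    _ ≤ ∑ j, if a i = b j ∧ a i ∈ G then (1 : ℝ) else 0 :=
      Finset.single_le_sum (f := fun j => if a i = b j ∧ a i ∈ G then (1 : ℝ) else 0)
        (fun j _ => h0 i j) (Finset.mem_univ j)
    _ ≤ collisions G a b :=
      Finset.single_le_sum
        (f := fun i => ∑ j, if a i = b j ∧ a i ∈ G then (1 : ℝ) else 0)
        (fun i _ => Finset.sum_nonneg fun j _ => h0 i j) (Finset.mem_univ i)

variable [Fintype ι] {p ν : ι → ℝ}

theorem sum_mul_sum_ite_eq (h : ι → ℝ) (G : Finset ι) (b : Fin k → ι) :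
    ∑ c, h c * ∑ j, (if c = b j ∧ c ∈ G then (1 : ℝ) else 0) =
      ∑ j, if b j ∈ G then h (b j) else 0 := by
  simp only [Finset.mul_sum]
  rw [Finset.sum_comm]
  refine Finset.sum_congr rfl fun j _ => ?_
  simp [ite_and]

theorem expect_collisions (hp : ∑ a, p a = 1) (hν : ∑ a, ν a = 1) (G : Finset ι) :
    ∑ b : Fin k → ι, ∑ a : Fin k → ι, (∏ i, p (a i)) * (∏ i, ν (b i)) * collisions G a b =
      k ^ 2 * ∑ c ∈ G, p c * ν c := by
  have h1 : ∀ b : Fin k → ι,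
      ∑ a : Fin k → ι, (∏ i, p (a i)) * (∏ i, ν (b i)) * collisions G a b =
        k * ((∏ i, ν (b i)) * ∑ j, if b j ∈ G then p (b j) else 0) := by
    intro b
    rw [← sum_mul_sum_ite_eq, mul_left_comm, ← sum_prodWeight_mul_sum hp, Finset.mul_sum]
    refine Finset.sum_congr rfl fun a _ => ?_
    simp only [collisions]
    ring
  simp only [h1]
  rw [← Finset.mul_sum, sum_prodWeight_mul_sum hν fun c => if c ∈ G then p c else 0]
  simp only [mul_ite, mul_zero, Finset.sum_ite_mem, Finset.univ_inter]
  simp only [mul_comm (ν _)]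
  ring

/-- The variance is split by conditioning on `b`: given `b`, the count is a sum of independent terms
`n b (a i)`, and its conditional mean is again an independent sum, over `j`. Each part contributes
`k ^ 3 * B ^ 2`; the first also contributes `k ^ 2 * B`. -/
theorem expect_collisions_sq_le (hp : ∑ a, p a = 1) (hν : ∑ a, ν a = 1) (hp0 : ∀ a, 0 ≤ p a)
    (hν0 : ∀ a, 0 ≤ ν a) (G : Finset ι) {B : ℝ} (hB : 0 ≤ B)
    (hpB : ∀ a ∈ G, p a ≤ B) (hνB : ∀ a ∈ G, ν a ≤ B) (M : ℝ) :
    ∑ b : Fin k → ι, ∑ a : Fin k → ι,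
        (∏ i, p (a i)) * (∏ i, ν (b i)) * (collisions G a b - M) ^ 2 ≤
      (k ^ 2 * ∑ c ∈ G, p c * ν c - M) ^ 2 + 2 * k ^ 3 * B ^ 2 + k ^ 2 * B := by
  set n : (Fin k → ι) → ι → ℝ := fun b c => ∑ j, if c = b j ∧ c ∈ G then 1 else 0 with hn
  set h : ι → ℝ := fun c => if c ∈ G then p c else 0 with hh
  have hW : ∀ b : Fin k → ι, 0 ≤ ∏ i, ν (b i) := fun b => Finset.prod_nonneg fun i _ => hν0 _
  have h1 : ∀ b : Fin k → ι,
      ∑ a : Fin k → ι, (∏ i, p (a i)) * (∏ i, ν (b i)) * (collisions G a b - M) ^ 2 ≤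
        (∏ i, ν (b i)) * (∑ j, k * h (b j) - M) ^ 2 +
          k * ∑ c, p c * ((∏ i, ν (b i)) * (n b c) ^ 2) := by
    intro b
    have e1 : ∑ a : Fin k → ι, (∏ i, p (a i)) * (∏ i, ν (b i)) * (collisions G a b - M) ^ 2 =
        (∏ i, ν (b i)) * ∑ a : Fin k → ι, (∏ i, p (a i)) * (∑ i, n b (a i) - M) ^ 2 := by
      rw [Finset.mul_sum]
      refine Finset.sum_congr rfl fun a _ => ?_
      simp only [collisions, hn]
      ring
    have e2 : ∑ c, p c * n b c = ∑ j, h (b j) := sum_mul_sum_ite_eq p G b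
    have e3 : ∑ c, p c * ((∏ i, ν (b i)) * (n b c) ^ 2) =
        (∏ i, ν (b i)) * ∑ c, p c * n b c ^ 2 := by
      rw [Finset.mul_sum]
      exact Finset.sum_congr rfl fun c _ => by ring
    rw [e1, sum_prodWeight_mul_sq hp, e2, e3, ← Finset.mul_sum]
    have : 0 ≤ (∏ i, ν (b i)) * (k * (∑ j, h (b j)) ^ 2) :=
      mul_nonneg (hW b) (by positivity)
    linarith
  have h2 : ∀ c, ∑ b : Fin k → ι, (∏ i, ν (b i)) * (n b c) ^ 2 ≤ k ^ 2 * B ^ 2 + k * B := by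
    intro c
    have e1 : ∀ b : Fin k → ι, n b c = ∑ j, (if b j = c ∧ c ∈ G then 1 else 0) - 0 := by
      intro b
      simp only [hn, eq_comm, sub_zero]
    simp only [e1]
    rw [sum_prodWeight_mul_sq hν (fun d => if d = c ∧ c ∈ G then 1 else 0)]
    by_cases hc : c ∈ G
    · simp only [hc, and_true, ite_pow, one_pow, ne_eq, OfNat.ofNat_ne_zero, not_false_eq_true,
        zero_pow, mul_ite, mul_one, mul_zero, Finset.sum_ite_eq', Finset.mem_univ, if_true,
        sub_zero]
      have := hνB c hc
      have h0 := hν0 c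
      have hk : (0 : ℝ) ≤ k := Nat.cast_nonneg k
      have : ν c ^ 2 ≤ B ^ 2 := pow_le_pow_left₀ h0 this 2
      have : (k : ℝ) * (ν c - ν c ^ 2) ≤ k * B :=
        mul_le_mul_of_nonneg_left (by nlinarith) hk
      rw [mul_pow]
      gcongr
    · have : 0 ≤ k ^ 2 * B ^ 2 + k * B := by positivity
      simpa [hc] using this
  have h3 : ∑ b : Fin k → ι, (∏ i, ν (b i)) * (∑ j, k * h (b j) - M) ^ 2 ≤
      (k ^ 2 * ∑ c ∈ G, p c * ν c - M) ^ 2 + k ^ 3 * B ^ 2 := by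
    rw [sum_prodWeight_mul_sq hν fun c => k * h c]
    have e1 : ∑ c, ν c * (k * h c) = k * ∑ c ∈ G, p c * ν c := by
      simp only [hh, mul_ite, mul_zero, Finset.sum_ite_mem, Finset.univ_inter, Finset.mul_sum]
      exact Finset.sum_congr rfl fun c _ => by ring
    have e2 : ∑ c, ν c * (k * h c) ^ 2 ≤ k ^ 2 * B ^ 2 := by
      calc ∑ c, ν c * (k * h c) ^ 2 ≤ ∑ c, ν c * (k ^ 2 * B ^ 2) := by
            refine Finset.sum_le_sum fun c _ => mul_le_mul_of_nonneg_left ?_ (hν0 c)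
            rw [mul_pow]
            refine mul_le_mul_of_nonneg_left ?_ (by positivity)
            simp only [hh]
            split_ifs with hc
            · exact pow_le_pow_left₀ (hp0 c) (hpB c hc) 2
            · rw [zero_pow two_ne_zero]
              positivity
        _ = k ^ 2 * B ^ 2 := by rw [← Finset.sum_mul, hν, one_mul]
    rw [e1]
    have e3 : (k : ℝ) * (∑ c, ν c * (k * h c) ^ 2 - (k * ∑ c ∈ G, p c * ν c) ^ 2) ≤
        k * (k ^ 2 * B ^ 2) :=
      mul_le_mul_of_nonneg_left (by nlinarith [sq_nonneg (k * ∑ c ∈ G, p c * ν c)])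
        (Nat.cast_nonneg k)
    have e4 : (k : ℝ) * (k * ∑ c ∈ G, p c * ν c) - M = k ^ 2 * ∑ c ∈ G, p c * ν c - M := by ring
    rw [e4]
    linarith
  have h4 : ∑ b : Fin k → ι, (k : ℝ) * ∑ c, p c * ((∏ i, ν (b i)) * (n b c) ^ 2) ≤
      k * (k ^ 2 * B ^ 2 + k * B) := by
    rw [← Finset.mul_sum, Finset.sum_comm]
    refine mul_le_mul_of_nonneg_left ?_ (Nat.cast_nonneg k)
    calc ∑ c, ∑ b : Fin k → ι, p c * ((∏ i, ν (b i)) * (n b c) ^ 2)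
        ≤ ∑ c, p c * (k ^ 2 * B ^ 2 + k * B) := by
          refine Finset.sum_le_sum fun c _ => ?_
          rw [← Finset.mul_sum]
          exact mul_le_mul_of_nonneg_left (h2 c) (hp0 c)
      _ = k ^ 2 * B ^ 2 + k * B := by rw [← Finset.sum_mul, hp, one_mul]
  calc _ ≤ ∑ b : Fin k → ι, ((∏ i, ν (b i)) * (∑ j, k * h (b j) - M) ^ 2 +
          k * ∑ c, p c * ((∏ i, ν (b i)) * (n b c) ^ 2)) := Finset.sum_le_sum fun b _ => h1 b
    _ ≤ _ := by
      rw [Finset.sum_add_distrib]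
      linarith

/-- If the selected pair is a collision whenever there is one, then the selected value `x` is
typically the one of a good block. -/
theorem abs_sum_selected_sub_le (hp : ∑ a, p a = 1) (hν : ∑ a, ν a = 1) (hp0 : ∀ a, 0 ≤ p a)
    (hν0 : ∀ a, 0 ≤ ν a) (G : Finset ι) {x : ι → ι → ℝ} (hx0 : ∀ a b, 0 ≤ x a b)
    (hx : ∀ a b, x a b ≤ p a * ν b) {F η B M : ℝ} (hF0 : 0 ≤ F) (hF1 : F ≤ 1) (hη : 0 ≤ η)
    (hB : 0 ≤ B) (hM : 0 < M) (hpB : ∀ a ∈ G, p a ≤ B) (hνB : ∀ a ∈ G, ν a ≤ B)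
    (hxF : ∀ a ∈ G, |x a a - F * (p a * ν a)| ≤ η * (p a * ν a))
    (sel : (Fin k → ι) → (Fin k → ι) → Fin k × Fin k)
    (hsel : ∀ (a b : Fin k → ι) (i j : Fin k), a i = b j → a (sel a b).1 = b (sel a b).2) :
    |∑ a : Fin k → ι, ∑ b : Fin k → ι,
        (∏ l : {l // l ≠ (sel a b).1}, p (a l)) * (∏ l : {l // l ≠ (sel a b).2}, ν (b l)) *
          x (a (sel a b).1) (b (sel a b).2) - F| ≤
      η + ((k ^ 2 * ∑ c ∈ G, p c * ν c - M) ^ 2 + 2 * k ^ 3 * B ^ 2 + k ^ 2 * B) / M ^ 2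
        + k ^ 2 * ∑ c ∈ Gᶜ, p c * ν c := by
  -- Three cases, one per term: a selected collision in `G` costs `η`; one in `Gᶜ` is paid by
  -- `collisions Gᶜ a b ≥ 1`; without a collision the Chebyshev term `(0 - M) ^ 2 / M ^ 2 = 1` pays.
  have hpt : ∀ a b : Fin k → ι,
      |(∏ l : {l // l ≠ (sel a b).1}, p (a l)) * (∏ l : {l // l ≠ (sel a b).2}, ν (b l)) *
          x (a (sel a b).1) (b (sel a b).2) - F * ((∏ i, p (a i)) * ∏ i, ν (b i))| ≤
        η * ((∏ i, p (a i)) * ∏ i, ν (b i)) +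
          (M ^ 2)⁻¹ * ((∏ i, p (a i)) * (∏ i, ν (b i)) * (collisions G a b - M) ^ 2) +
          (∏ i, p (a i)) * (∏ i, ν (b i)) * collisions Gᶜ a b := by
    intro a b
    set i := (sel a b).1
    set j := (sel a b).2
    rw [Fintype.prod_eq_mul_prod_subtype_ne (fun l => p (a l)) i,
      Fintype.prod_eq_mul_prod_subtype_ne (fun l => ν (b l)) j]
    set R := ∏ l : {l // l ≠ i}, p (a l)
    set R' := ∏ l : {l // l ≠ j}, ν (b l)
    have hR : 0 ≤ R := Finset.prod_nonneg fun l _ => hp0 _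
    have hR' : 0 ≤ R' := Finset.prod_nonneg fun l _ => hν0 _
    have hc := collisions_nonneg Gᶜ a b
    have hpν : 0 ≤ p (a i) * ν (b j) := mul_nonneg (hp0 _) (hν0 _)
    have hM2 : 0 ≤ (M ^ 2)⁻¹ * (collisions G a b - M) ^ 2 := by positivity
    suffices H : |x (a i) (b j) - F * (p (a i) * ν (b j))| ≤
        p (a i) * ν (b j) *
          (η + (M ^ 2)⁻¹ * (collisions G a b - M) ^ 2 + collisions Gᶜ a b) by
      have e : R * R' * x (a i) (b j) - F * (p (a i) * R * (ν (b j) * R')) =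
          R * R' * (x (a i) (b j) - F * (p (a i) * ν (b j))) := by ring
      rw [e, abs_mul, abs_of_nonneg (mul_nonneg hR hR')]
      refine (mul_le_mul_of_nonneg_left H (mul_nonneg hR hR')).trans (le_of_eq ?_)
      ring
    have htriv : |x (a i) (b j) - F * (p (a i) * ν (b j))| ≤ p (a i) * ν (b j) := by
      have := hx (a i) (b j)
      have := hx0 (a i) (b j)
      rw [abs_le]
      constructor <;> nlinarith
    by_cases hij : a i = b j
    · by_cases hG : a i ∈ G
      · have := hxF _ hG
        rw [← hij]
        rw [← hij] at hpν
        refine this.trans ?_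
        rw [mul_comm]
        exact mul_le_mul_of_nonneg_left (by linarith) hpν
      · have := one_le_collisions hij (Finset.mem_compl.2 hG)
        refine htriv.trans (le_mul_of_one_le_right hpν (by linarith))
    · have h0 : collisions G a b = 0 := by
        refine Finset.sum_eq_zero fun i' _ => Finset.sum_eq_zero fun j' _ => ?_
        rw [if_neg]
        exact fun h => hij (hsel a b i' j' h.1)
      refine htriv.trans (le_mul_of_one_le_right hpν ?_)
      rw [h0, zero_sub, neg_sq, inv_mul_cancel₀ (by positivity)]
      linarith
  rw [show F = ∑ a : Fin k → ι, ∑ b : Fin k → ι, F * ((∏ i, p (a i)) * ∏ i, ν (b i)) by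
    simp only [← Finset.mul_sum, sum_prodWeight hν, mul_one, sum_prodWeight hp]]
  simp only [← Finset.sum_sub_distrib]
  refine (Finset.abs_sum_le_sum_abs _ _).trans ((Finset.sum_le_sum fun a _ =>
    (Finset.abs_sum_le_sum_abs _ _).trans (Finset.sum_le_sum fun b _ => hpt a b)).trans ?_)
  simp only [Finset.sum_add_distrib, ← Finset.mul_sum]
  rw [Finset.sum_comm (f := fun a b => (∏ i, p (a i)) * (∏ i, ν (b i)) * collisions Gᶜ a b),
    Finset.sum_comm (f := fun a b => (∏ i, p (a i)) * (∏ i, ν (b i)) *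
      (collisions G a b - M) ^ 2), expect_collisions hp hν]
  have h1 := expect_collisions_sq_le (k := k) hp hν hp0 hν0 G hB hpB hνB M
  have h2 := mul_le_mul_of_nonneg_left h1 (show 0 ≤ (M ^ 2)⁻¹ by positivity)
  have h3 : η * ∑ a : Fin k → ι, (∏ i, p (a i)) * ∑ b : Fin k → ι, ∏ i, ν (b i) = η := by
    rw [sum_prodWeight hν]
    simp [sum_prodWeight hp]
  rw [div_eq_inv_mul]
  linarith

end Collisions

/-- Parseval's identity for a finite orthogonal system. -/
theorem sum_norm_sq_sum_of_orthogonal {S T : Type*} [Fintype S] [DecidableEq T] (J : Finset T)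
    (f : T → S → ℂ) (n : ℝ)
    (hf : ∀ P ∈ J, ∀ Q ∈ J, ∑ s, conj (f P s) * f Q s = if P = Q then (n : ℂ) else 0)
    (c : T → ℂ) : ∑ s, ‖∑ P ∈ J, c P * f P s‖ ^ 2 = n * ∑ P ∈ J, ‖c P‖ ^ 2 := by
  apply Complex.ofReal_injective
  push_cast
  simp only [← Complex.conj_mul', map_sum, map_mul, Finset.sum_mul_sum]
  rw [Finset.mul_sum, Finset.sum_comm]
  refine Finset.sum_congr rfl fun P hP => ?_
  rw [Finset.sum_comm]
  have h : ∀ Q ∈ J, ∑ s, conj (c P) * conj (f P s) * (c Q * f Q s) =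
      if P = Q then n * (conj (c P) * c Q) else 0 := by
    intro Q hQ
    have : ∀ s, conj (c P) * conj (f P s) * (c Q * f Q s) =
        conj (c P) * c Q * (conj (f P s) * f Q s) := fun s => by ring
    simp only [this, ← Finset.mul_sum, hf P hP Q hQ]
    split_ifs <;> ring
  rw [Finset.sum_congr rfl h, Finset.sum_ite_eq, if_pos hP]

/-! ### The random block measurement and its second moment. -/

section RandomBlocks

variable {d N q : ℕ} [NeZero N] [NeZero q]

/-- Orthogonality of characters of `(ℤ/3)^d`. Signs would not suffice: modulo 2 the pairs `(i, j)`
and `(j, i)` give the same character. -/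
theorem sum_conj_phase_mul_phase {P Q : Fin d × Fin d} (hP : P.1 ≠ P.2) :
    ∑ s : Fin d → ZMod 3, conj (ZMod.stdAddChar (s P.2 - s P.1)) *
      ZMod.stdAddChar (s Q.2 - s Q.1) = if P = Q then ((3 ^ d : ℝ) : ℂ) else 0 := by
  classical
  let ev : Fin d → (Fin d → ZMod 3) →+ ZMod 3 := fun i => Pi.evalAddMonoidHom _ i
  let l : (Fin d → ZMod 3) →+ ZMod 3 := (ev Q.2 - ev Q.1) - (ev P.2 - ev P.1)
  have hl : ∀ s, l s = (s Q.2 - s Q.1) - (s P.2 - s P.1) := fun s => rfl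
  have h1 : ∀ s : Fin d → ZMod 3, conj (ZMod.stdAddChar (s P.2 - s P.1)) *
      ZMod.stdAddChar (s Q.2 - s Q.1) = (ZMod.stdAddChar.compAddMonoidHom l : AddChar _ ℂ) s := by
    intro s
    rw [AddChar.compAddMonoidHom_apply, hl, ← AddChar.map_neg_eq_conj, ← AddChar.map_add_eq_mul]
    congr 1
    ring
  simp only [h1]
  split_ifs with h
  · have : l = 0 := by simp [l, h]
    simp [this]
  · refine AddChar.sum_eq_zero_of_ne_one fun h2 => h ?_
    have h3 : ∀ s, l s = 0 := by
      intro s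
      apply ZMod.injective_stdAddChar
      rw [AddChar.map_zero_eq_one, ← AddChar.compAddMonoidHom_apply, h2, AddChar.one_apply]
    -- Evaluating the vanishing form at the unit vectors of `P.2` and `P.1` recovers `Q`, since `-1
    -- ≠ 1` modulo 3.
    have e2 := h3 (Pi.single P.2 1)
    have e1 := h3 (Pi.single P.1 1)
    simp only [hl, Pi.single_apply, if_true, hP, hP.symm, if_false] at e1 e2
    have hQ1 : P.2 = Q.2 := by
      by_contra hne
      have hne' : ¬ Q.2 = P.2 := fun h => hne h.symm
      rw [if_neg hne'] at e2
      split_ifs at e2 <;> revert e2 <;> decide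
    have hQ2 : P.1 = Q.1 := by
      by_contra hne
      have hne' : ¬ Q.1 = P.1 := fun h => hne h.symm
      rw [if_neg hne'] at e1
      split_ifs at e1 <;> revert e1 <;> decide
    exact Prod.ext hQ2 hQ1

/-- The hash of the label `x` with shifts `g`. -/
def shiftHash (g : ZMod N → ZMod q) (x : ZMod N × ZMod q) : ZMod q := x.2 + g x.1

/-- Labels with equal first component never collide. Otherwise translating `g` at `x.1` moves the
hash of `x` alone, so every difference of hashes is equally likely. -/
theorem sum_shiftHash_eq_le {x y : ZMod N × ZMod q} (hxy : x ≠ y) :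
    q * ∑ g : ZMod N → ZMod q, (if shiftHash g x = shiftHash g y then (1 : ℝ) else 0) ≤
      Fintype.card (ZMod N → ZMod q) := by
  by_cases h : x.1 = y.1
  · have : ∀ g : ZMod N → ZMod q, ¬ shiftHash g x = shiftHash g y := by
      intro g hg
      simp only [shiftHash, h, add_left_inj] at hg
      exact hxy (Prod.ext h hg)
    simp only [this, if_false, Finset.sum_const_zero, mul_zero]
    positivity
  · have h1 : ∀ c : ZMod q,
        ∑ g : ZMod N → ZMod q, (if shiftHash g x = shiftHash g y then (1 : ℝ) else 0) =
        ∑ g : ZMod N → ZMod q, (if c = shiftHash g y - shiftHash g x then (1 : ℝ) else 0) := by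
      intro c
      rw [← Equiv.sum_comp (Equiv.addRight (Pi.single x.1 c : ZMod N → ZMod q))]
      refine Finset.sum_congr rfl fun g _ => if_congr ?_ rfl rfl
      simp only [shiftHash, Equiv.coe_addRight, Pi.add_apply, Pi.single_eq_same,
        Pi.single_eq_of_ne (Ne.symm h), add_zero]
      rw [eq_sub_iff_add_eq, add_comm c, add_assoc]
    have h2 : (q : ℝ) *
        ∑ g : ZMod N → ZMod q, (if shiftHash g x = shiftHash g y then (1 : ℝ) else 0) =
        ∑ c : ZMod q, ∑ g : ZMod N → ZMod q,
          (if c = shiftHash g y - shiftHash g x then (1 : ℝ) else 0) := by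
      simp only [← h1, Finset.sum_const, Finset.card_univ, ZMod.card, nsmul_eq_mul]
    rw [h2, Finset.sum_comm]
    simp

/-- Random Kraus operators: random phases `s`, and a Fourier transform within each class of a
random hash. -/
noncomputable def blockKraus (e : Fin d → ZMod N × ZMod q)
    (u : (ZMod N → ZMod q) × (Fin d → ZMod 3)) (a : ZMod N) : Matrix (ZMod q) (Fin d) ℂ :=
  Matrix.of fun w y => ((√N : ℝ) : ℂ)⁻¹ * (ZMod.stdAddChar (a * (e y).1) *
    ZMod.stdAddChar (u.2 y) * if w = shiftHash u.1 (e y) then 1 else 0)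

theorem blockKraus_conjTranspose_mul (e : Fin d → ZMod N × ZMod q)
    (u : (ZMod N → ZMod q) × (Fin d → ZMod 3)) (a : ZMod N) (y z : Fin d) :
    ((blockKraus e u a)ᴴ * blockKraus e u a) y z =
      (N : ℂ)⁻¹ * (ZMod.stdAddChar (a * ((e z).1 - (e y).1)) *
        ZMod.stdAddChar (u.2 z - u.2 y) *
          if shiftHash u.1 (e y) = shiftHash u.1 (e z) then 1 else 0) := by
  have hN : ((√N : ℝ) : ℂ)⁻¹ * ((√N : ℝ) : ℂ)⁻¹ = (N : ℂ)⁻¹ := by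
    rw [← mul_inv, ← Complex.ofReal_mul, Real.mul_self_sqrt (Nat.cast_nonneg N)]
    simp
  simp only [Matrix.mul_apply, Matrix.conjTranspose_apply, blockKraus, Matrix.of_apply,
    RCLike.star_def, map_mul, map_inv₀, Complex.conj_ofReal, apply_ite conj, map_one, map_zero,
    ← AddChar.map_neg_eq_conj]
  have : ∀ w : ZMod q, ((√N : ℝ) : ℂ)⁻¹ * (ZMod.stdAddChar (-(a * (e y).1)) *
      ZMod.stdAddChar (-u.2 y) * if w = shiftHash u.1 (e y) then 1 else 0) *
      (((√N : ℝ) : ℂ)⁻¹ * (ZMod.stdAddChar (a * (e z).1) *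
      ZMod.stdAddChar (u.2 z) * if w = shiftHash u.1 (e z) then 1 else 0)) =
      if w = shiftHash u.1 (e y) then (N : ℂ)⁻¹ * (ZMod.stdAddChar (a * ((e z).1 - (e y).1)) *
        ZMod.stdAddChar (u.2 z - u.2 y) *
          if w = shiftHash u.1 (e z) then 1 else 0) else 0 := by
    intro w
    rw [mul_sub, sub_eq_neg_add, sub_eq_neg_add, AddChar.map_add_eq_mul, AddChar.map_add_eq_mul,
      ← hN]
    split_ifs <;> ring
  simp only [this, Finset.sum_ite_eq', Finset.mem_univ, if_true]

/-- Off the diagonal, summing over `a` kills pairs whose first labels differ; pairs with the same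
first label have different hashes. -/
theorem sum_blockKraus {e : Fin d → ZMod N × ZMod q} (he : Function.Injective e)
    (u : (ZMod N → ZMod q) × (Fin d → ZMod 3)) :
    ∑ a, (blockKraus e u a)ᴴ * blockKraus e u a = 1 := by
  ext y z
  simp only [Matrix.sum_apply, blockKraus_conjTranspose_mul]
  rw [← Finset.mul_sum, ← Finset.sum_mul, ← Finset.sum_mul,
    AddChar.sum_mulShift _ (ZMod.isPrimitive_stdAddChar N), ZMod.card, Matrix.one_apply]
  have hN : (N : ℂ) ≠ 0 := by exact_mod_cast NeZero.ne N
  by_cases h : y = z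
  · subst h
    simp [hN]
  · rw [if_neg h]
    by_cases h1 : (e z).1 - (e y).1 = 0
    · rw [if_neg (c := shiftHash u.1 (e y) = shiftHash u.1 (e z))]
      · simp
      · intro h2
        rw [sub_eq_zero] at h1
        simp only [shiftHash, h1, add_left_inj] at h2
        exact h (he (Prod.ext h1.symm h2))
    · simp [h1]

theorem star_mulVec_dotProduct_mulVec {X D : Type*} [Fintype X] [Fintype D] (M : Matrix X D ℂ)
    (ψ φ : D → ℂ) :
    star (M *ᵥ ψ) ⬝ᵥ (M *ᵥ φ) = ∑ P : D × D, star (ψ P.1) * φ P.2 * (Mᴴ * M) P.1 P.2 := by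
  rw [Matrix.star_mulVec, Matrix.dotProduct_mulVec, Matrix.vecMul_vecMul,
    ← Matrix.dotProduct_mulVec, Fintype.sum_prod_type]
  simp only [dotProduct, Matrix.mulVec, Finset.mul_sum, Pi.star_apply]
  exact Finset.sum_congr rfl fun _ _ => Finset.sum_congr rfl fun _ _ => by ring

/-- The diagonal of `(K a)ᴴ * K a` is exactly `1 / N`, so the deviation is purely off-diagonal. The
random phase is isolated as the last factor for use in Parseval's identity. -/
theorem blockKraus_overlap_sub (e : Fin d → ZMod N × ZMod q)
    (u : (ZMod N → ZMod q) × (Fin d → ZMod 3)) (a : ZMod N) (ψ φ : Fin d → ℂ) :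
    (N : ℂ) * (star (blockKraus e u a *ᵥ ψ) ⬝ᵥ (blockKraus e u a *ᵥ φ)) - star ψ ⬝ᵥ φ =
      ∑ P ∈ (Finset.univ : Finset (Fin d)).offDiag,
        (star (ψ P.1) * φ P.2 * (ZMod.stdAddChar (a * ((e P.2).1 - (e P.1).1)) *
          if shiftHash u.1 (e P.1) = shiftHash u.1 (e P.2) then 1 else 0)) *
          ZMod.stdAddChar (u.2 P.2 - u.2 P.1) := by
  have hN : (N : ℂ) ≠ 0 := by exact_mod_cast NeZero.ne N
  rw [star_mulVec_dotProduct_mulVec, Finset.mul_sum]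
  simp only [blockKraus_conjTranspose_mul]
  rw [← Finset.univ_product_univ, ← Finset.diag_union_offDiag,
    Finset.sum_union (Finset.disjoint_diag_offDiag _)]
  rw [add_comm, ← add_sub, Finset.sum_diag]
  have h1 : ∑ i, (N : ℂ) * (star (ψ i) * φ i * ((N : ℂ)⁻¹ * (ZMod.stdAddChar
      (a * ((e i).1 - (e i).1)) * ZMod.stdAddChar (u.2 i - u.2 i) *
      if shiftHash u.1 (e i) = shiftHash u.1 (e i) then 1 else 0))) - star ψ ⬝ᵥ φ = 0 := by
    rw [sub_eq_zero]
    refine Finset.sum_congr rfl fun i _ => ?_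
    simp only [sub_self, mul_zero, AddChar.map_zero_eq_one, if_true, Pi.star_apply]
    field_simp
  rw [h1, add_zero]
  refine Finset.sum_congr rfl fun P _ => ?_
  field_simp

/-- The second moment of the deviation of the overlap of two block components. -/
theorem sum_norm_sq_blockKraus_overlap_sub_le {e : Fin d → ZMod N × ZMod q}
    (he : Function.Injective e) (a : ZMod N) {ψ φ : Fin d → ℂ} (hψ : normSqVec ψ = 1)
    (hφ : normSqVec φ = 1) :
    (Fintype.card ((ZMod N → ZMod q) × (Fin d → ZMod 3)) : ℝ)⁻¹ *
      ∑ u, ‖(N : ℂ) * (star (blockKraus e u a *ᵥ ψ) ⬝ᵥ (blockKraus e u a *ᵥ φ))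
        - star ψ ⬝ᵥ φ‖ ^ 2 ≤ (q : ℝ)⁻¹ := by
  classical
  have hq : (0 : ℝ) < q := by exact_mod_cast Nat.pos_of_neZero q
  simp only [blockKraus_overlap_sub, Fintype.sum_prod_type]
  -- Averaging over the phases removes all cross terms between distinct pairs.
  have h1 : ∀ g : ZMod N → ZMod q, ∑ s : Fin d → ZMod 3,
      ‖∑ P ∈ (Finset.univ : Finset (Fin d)).offDiag,
        (star (ψ P.1) * φ P.2 * (ZMod.stdAddChar (a * ((e P.2).1 - (e P.1).1)) *
          if shiftHash g (e P.1) = shiftHash g (e P.2) then 1 else 0)) *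
          ZMod.stdAddChar (s P.2 - s P.1)‖ ^ 2 =
      3 ^ d * ∑ P ∈ (Finset.univ : Finset (Fin d)).offDiag, ‖ψ P.1‖ ^ 2 * ‖φ P.2‖ ^ 2 *
        if shiftHash g (e P.1) = shiftHash g (e P.2) then 1 else 0 := by
    intro g
    rw [sum_norm_sq_sum_of_orthogonal _
      (fun (P : Fin d × Fin d) (s : Fin d → ZMod 3) => ZMod.stdAddChar (s P.2 - s P.1)) (3 ^ d)
      (fun P hP Q _ => sum_conj_phase_mul_phase (Finset.mem_offDiag.1 hP).2.2)]
    congr 1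
    refine Finset.sum_congr rfl fun P _ => ?_
    rw [norm_mul, norm_mul, norm_mul, AddChar.norm_apply, norm_star, one_mul, mul_pow, mul_pow]
    split_ifs <;> simp
  simp only [h1]
  rw [← Finset.mul_sum, Finset.sum_comm]
  simp only [← Finset.mul_sum]
  -- Each pair survives the hash with probability at most `1 / q`, and the weights of all pairs sum
  -- to at most `1`.
  have h2 : ∑ P ∈ (Finset.univ : Finset (Fin d)).offDiag, ‖ψ P.1‖ ^ 2 * ‖φ P.2‖ ^ 2 *
      ∑ g : ZMod N → ZMod q, (if shiftHash g (e P.1) = shiftHash g (e P.2) then (1 : ℝ) else 0) ≤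
      (q : ℝ)⁻¹ * Fintype.card (ZMod N → ZMod q) := by
    calc _ ≤ ∑ P ∈ (Finset.univ : Finset (Fin d)).offDiag, ‖ψ P.1‖ ^ 2 * ‖φ P.2‖ ^ 2 *
          ((q : ℝ)⁻¹ * Fintype.card (ZMod N → ZMod q)) := by
          refine Finset.sum_le_sum fun P hP => mul_le_mul_of_nonneg_left ?_ (by positivity)
          rw [inv_mul_eq_div, le_div_iff₀' hq]
          exact sum_shiftHash_eq_le fun h => (Finset.mem_offDiag.1 hP).2.2 (he h)
      _ ≤ ∑ P : Fin d × Fin d, ‖ψ P.1‖ ^ 2 * ‖φ P.2‖ ^ 2 *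
          ((q : ℝ)⁻¹ * Fintype.card (ZMod N → ZMod q)) :=
          Finset.sum_le_sum_of_subset_of_nonneg (Finset.subset_univ _) fun P _ _ => by positivity
      _ = _ := by
          rw [← Finset.sum_mul, Fintype.sum_prod_type]
          simp only [← Finset.mul_sum, ← Finset.sum_mul]
          change normSqVec ψ * normSqVec φ * _ = _
          rw [hψ, hφ, one_mul, one_mul]
  have hcard : (Fintype.card ((ZMod N → ZMod q) × (Fin d → ZMod 3)) : ℝ) =
      Fintype.card (ZMod N → ZMod q) * 3 ^ d := by
    rw [Fintype.card_prod, Fintype.card_fun (α := Fin d)]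
    simp
  have hc : (0 : ℝ) < Fintype.card (ZMod N → ZMod q) := by exact_mod_cast Fintype.card_pos
  rw [hcard, inv_mul_le_iff₀ (by positivity)]
  calc _ ≤ (3 : ℝ) ^ d * ((q : ℝ)⁻¹ * Fintype.card (ZMod N → ZMod q)) :=
        mul_le_mul_of_nonneg_left h2 (by positivity)
    _ = _ := by ring

end RandomBlocks

/-! ### The bias of a round. -/

theorem norm_star_dotProduct_sq_le {X : Type*} [Fintype X] (α β : X → ℂ) :
    ‖star α ⬝ᵥ β‖ ^ 2 ≤ normSqVec α * normSqVec β := by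
  have h := sum_normSq_symm α β (-1) (by norm_num)
  have h0 : 0 ≤ ∑ x, ∑ y, ‖(2⁻¹ : ℂ) * (β x * α y + ((-1 : ℝ) : ℂ) * (β y * α x))‖ ^ 2 := by
    positivity
  rw [h] at h0
  linarith

theorem star_dotProduct_self {X : Type*} [Fintype X] (α : X → ℂ) :
    star α ⬝ᵥ α = (normSqVec α : ℂ) := by
  simp [dotProduct, normSqVec, Complex.conj_mul']

theorem normSqVec_nonneg {X : Type*} [Fintype X] (α : X → ℂ) : 0 ≤ normSqVec α :=
  Finset.sum_nonneg fun _ _ => by positivity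

theorem sum_normSqVec_kraus {ι X D : Type*} [Fintype ι] [Fintype X] [Fintype D] [DecidableEq D]
    {M : ι → Matrix X D ℂ} (hM : ∑ a, (M a)ᴴ * M a = 1) (ψ : D → ℂ) :
    ∑ a, normSqVec (M a *ᵥ ψ) = normSqVec ψ := by
  apply Complex.ofReal_injective
  push_cast
  simp only [← star_dotProduct_self, Matrix.star_mulVec]
  simp only [← Matrix.dotProduct_mulVec, Matrix.mulVec_mulVec]
  rw [← dotProduct_sum, ← Matrix.sum_mulVec, hM, Matrix.one_mulVec]

theorem normSqVec_eq_one {d : ℕ} {ψ : EuclideanSpace ℂ (Fin d)} (hψ : ‖ψ‖ = 1) :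
    normSqVec (⇑ψ) = 1 := by
  rw [normSqVec, ← EuclideanSpace.norm_sq_eq, hψ, one_pow]

theorem inner_eq_dotProduct {d : ℕ} (ψ φ : EuclideanSpace ℂ (Fin d)) :
    inner ℂ ψ φ = star (⇑ψ) ⬝ᵥ ⇑φ := by
  rw [EuclideanSpace.inner_eq_star_dotProduct, dotProduct_comm]

theorem abs_norm_sq_sub_norm_sq_le {z z₀ : ℂ} {η : ℝ} (hz₀ : ‖z₀‖ ≤ 1) (hη : η ≤ 1 / 2)
    (h : ‖z - z₀‖ ≤ η) : |‖z‖ ^ 2 - ‖z₀‖ ^ 2| ≤ 3 * η := by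
  have h1 : |‖z‖ - ‖z₀‖| ≤ η := (abs_norm_sub_norm_le z z₀).trans h
  rw [abs_le] at h1 ⊢
  have := norm_nonneg z
  have := norm_nonneg z₀
  constructor <;> nlinarith

theorem abs_mul_sub_one_le {x y η : ℝ} (hη : η ≤ 1 / 2) (hx : |x - 1| ≤ η) (hy : |y - 1| ≤ η) :
    |x * y - 1| ≤ 3 * η := by
  have hη0 : 0 ≤ η := (abs_nonneg _).trans hx
  have e : x * y - 1 = (x - 1) * (y - 1) + (x - 1) + (y - 1) := by ring
  rw [e]
  have h1 : |(x - 1) * (y - 1)| ≤ η * η := by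
    rw [abs_mul]
    exact mul_le_mul hx hy (abs_nonneg _) hη0
  have := abs_add_three ((x - 1) * (y - 1)) (x - 1) (y - 1)
  nlinarith

/-- Used for bad blocks, whose weights have no a priori cap: `x * y ≤ D + 2`, and `D / η ^ 2`
dominates both `D` and `1`. -/
theorem mul_le_three_mul_div {x y D η : ℝ} (hη0 : 0 < η) (hη : η ≤ 1 / 2) (hD : η ^ 2 ≤ D)
    (h : (x - 1) ^ 2 + (y - 1) ^ 2 ≤ D) : x * y ≤ 3 * (D / η ^ 2) := by
  have h1 : 1 ≤ D / η ^ 2 := by rwa [le_div_iff₀ (by positivity), one_mul]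
  have h2 : D ≤ D / η ^ 2 := by
    rw [le_div_iff₀ (by positivity)]
    exact mul_le_of_le_one_right ((sq_nonneg η).trans hD) (by nlinarith)
  nlinarith [sq_nonneg (x - y), sq_nonneg (x + y - 2)]

theorem mul_abs_eq_abs_mul {c x : ℝ} (hc : 0 < c) : c * |x| = |c * x| := by
  rw [abs_mul, abs_of_pos hc]

theorem collision_variance_eq {k N S : ℝ} (hk : k ≠ 0) (hN : N ≠ 0) :
    ((k ^ 2 * S - k ^ 2 / N) ^ 2 + 2 * k ^ 3 * (2 / N) ^ 2 + k ^ 2 * (2 / N)) /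
      (k ^ 2 / N) ^ 2 = (N * S - 1) ^ 2 + 8 / k + 2 * N / k ^ 2 := by
  have h1 : k ^ 2 * S - k ^ 2 / N = (k ^ 2 / N) * (N * S - 1) := by field_simp
  have h2 : k ^ 2 / N ≠ 0 := by positivity
  rw [h1, add_div, add_div, mul_pow, mul_div_cancel_left₀ _ (pow_ne_zero 2 h2)]
  congr 1
  · congr 1
    field_simp
    ring
  · field_simp

set_option maxHeartbeats 400000 in
/-- The bias of a round, in terms of the deviations of the blocks from their typical behaviour. -/
theorem abs_sum_selected_sub_le_of_deviation {ι : Type*} [Fintype ι] [DecidableEq ι] [Nonempty ι]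
    {k : ℕ} {p ν : ι → ℝ} (hp : ∑ a, p a = 1) (hν : ∑ a, ν a = 1) (hp0 : ∀ a, 0 ≤ p a)
    (hν0 : ∀ a, 0 ≤ ν a) {X : ι → ι → ℂ} (hX : ∀ a b, ‖X a b‖ ^ 2 ≤ p a * ν b) {z₀ : ℂ}
    (hz₀ : ‖z₀‖ ≤ 1) {η L : ℝ} (hη0 : 0 < η) (hη : η ≤ 1 / 2) (hL : 1 ≤ L)
    (hk : L * √(Fintype.card ι) ≤ k) (hk' : k ≤ 2 * L * √(Fintype.card ι))
    (sel : (Fin k → ι) → (Fin k → ι) → Fin k × Fin k)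
    (hsel : ∀ (a b : Fin k → ι) (i j : Fin k), a i = b j → a (sel a b).1 = b (sel a b).2) :
    |∑ a : Fin k → ι, ∑ b : Fin k → ι,
        (∏ l : {l // l ≠ (sel a b).1}, p (a l)) * (∏ l : {l // l ≠ (sel a b).2}, ν (b l)) *
          ‖X (a (sel a b).1) (b (sel a b).2)‖ ^ 2 - ‖z₀‖ ^ 2| ≤
      33 * η + 10 / L + 15 * L ^ 2 / η ^ 2 * ((Fintype.card ι : ℝ)⁻¹ *
        ∑ a, (((Fintype.card ι : ℝ) * p a - 1) ^ 2 + ((Fintype.card ι : ℝ) * ν a - 1) ^ 2 +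
          ‖(Fintype.card ι : ℂ) * X a a - z₀‖ ^ 2)) := by
  classical
  set N : ℝ := (Fintype.card ι : ℝ) with hN
  have hNC : (Fintype.card ι : ℂ) = (N : ℂ) := by simp [hN]
  have hN1 : 1 ≤ N := by
    rw [hN]
    exact_mod_cast Fintype.card_pos (α := ι)
  have hN0 : 0 < N := by linarith
  rw [hNC]
  set D : ι → ℝ := fun a => (N * p a - 1) ^ 2 + (N * ν a - 1) ^ 2 + ‖(N : ℂ) * X a a - z₀‖ ^ 2
    with hD
  have hD0 : ∀ a, 0 ≤ D a := fun a => by positivity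
  -- Good blocks are typical in both weights and in the overlap; any bad block has `D a ≥ η ^ 2`, so
  -- Markov's inequality limits their number.
  set G : Finset ι := Finset.univ.filter fun a =>
    |N * p a - 1| ≤ η ∧ |N * ν a - 1| ≤ η ∧ ‖(N : ℂ) * X a a - z₀‖ ≤ η with hG
  have hbad : ∀ a ∈ Gᶜ, η ^ 2 ≤ D a := by
    intro a ha
    simp only [hG, Finset.mem_compl, Finset.mem_filter, Finset.mem_univ, true_and, not_and_or,
      not_le] at ha
    have h1 := sq_nonneg (N * p a - 1)
    have h2 := sq_nonneg (N * ν a - 1)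
    have h3 := sq_nonneg ‖(N : ℂ) * X a a - z₀‖
    simp only [hD]
    rcases ha with ha | ha | ha
    · have := pow_le_pow_left₀ hη0.le ha.le 2
      rw [sq_abs] at this
      linarith
    · have := pow_le_pow_left₀ hη0.le ha.le 2
      rw [sq_abs] at this
      linarith
    · have := pow_le_pow_left₀ hη0.le ha.le 2
      linarith
  have hgood : ∀ a ∈ G, |N * p a - 1| ≤ η ∧ |N * ν a - 1| ≤ η ∧
      ‖(N : ℂ) * X a a - z₀‖ ≤ η := fun a ha => (Finset.mem_filter.1 ha).2
  have hcap : ∀ {x : ℝ}, |N * x - 1| ≤ η → x ≤ 2 / N := by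
    intro x hx
    rw [le_div_iff₀ hN0]
    linarith [(abs_le.1 hx).2]
  have hpν : ∀ a ∈ G, |N ^ 2 * (p a * ν a) - 1| ≤ 3 * η := by
    intro a ha
    have h := abs_mul_sub_one_le hη (hgood a ha).1 (hgood a ha).2.1
    rwa [show N * p a * (N * ν a) = N ^ 2 * (p a * ν a) by ring] at h
  -- After scaling by `N ^ 2` the error is at most `3η + 3η`, while the product of weights is at
  -- least `1 / 4`; hence `24 = 6 * 4`.
  have hxF : ∀ a ∈ G, |‖X a a‖ ^ 2 - ‖z₀‖ ^ 2 * (p a * ν a)| ≤ 24 * η * (p a * ν a) := by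
    intro a ha
    have h1 := hpν a ha
    have h2 := abs_norm_sq_sub_norm_sq_le hz₀ hη (hgood a ha).2.2
    rw [norm_mul, Complex.norm_real, Real.norm_eq_abs, abs_of_pos hN0, mul_pow] at h2
    have h3 : 1 / 4 ≤ N ^ 2 * (p a * ν a) := by
      have e1 := (abs_le.1 (hgood a ha).1).1
      have e2 := (abs_le.1 (hgood a ha).2.1).1
      have : (1 / 2) * (1 / 2) ≤ (N * p a) * (N * ν a) :=
        mul_le_mul (by linarith) (by linarith) (by norm_num) (by linarith)
      linarith
    have h4 : ‖z₀‖ ^ 2 ≤ 1 := pow_le_one₀ (norm_nonneg _) hz₀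
    have h4' : 0 ≤ ‖z₀‖ ^ 2 := by positivity
    have h5 : N ^ 2 * |‖X a a‖ ^ 2 - ‖z₀‖ ^ 2 * (p a * ν a)| ≤ 6 * η := by
      rw [mul_abs_eq_abs_mul (by positivity)]
      have e : N ^ 2 * (‖X a a‖ ^ 2 - ‖z₀‖ ^ 2 * (p a * ν a)) =
          (N ^ 2 * ‖X a a‖ ^ 2 - ‖z₀‖ ^ 2) - ‖z₀‖ ^ 2 * (N ^ 2 * (p a * ν a) - 1) := by ring
      rw [e]
      refine (abs_sub _ _).trans ?_
      rw [abs_mul, abs_of_nonneg h4']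
      have := mul_le_mul h4 h1 (abs_nonneg _) zero_le_one
      linarith
    have h6 : N ^ 2 * |‖X a a‖ ^ 2 - ‖z₀‖ ^ 2 * (p a * ν a)| ≤
        N ^ 2 * (24 * η * (p a * ν a)) := by
      have := mul_le_mul_of_nonneg_left h3 (show 0 ≤ 24 * η by positivity)
      linarith
    exact le_of_mul_le_mul_left h6 (by positivity)
  have hk0 : (0 : ℝ) < k := lt_of_lt_of_le (by positivity) hk
  have hM : 0 < (k : ℝ) ^ 2 / N := by positivity
  -- `M = k ^ 2 / N` is the mean number of collisions for uniform outcomes; `B = 2 / N` caps the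
  -- weights of good blocks.
  have key := abs_sum_selected_sub_le hp hν hp0 hν0 G (x := fun a b => ‖X a b‖ ^ 2)
    (fun a b => by positivity) hX (F := ‖z₀‖ ^ 2) (by positivity)
    (pow_le_one₀ (norm_nonneg _) hz₀) (η := 24 * η) (by positivity) (B := 2 / N) (by positivity)
    hM (fun a ha => hcap (hgood a ha).1) (fun a ha => hcap (hgood a ha).2.1) hxF sel hsel
  refine key.trans ?_
  set E : ℝ := N⁻¹ * ∑ a, D a with hE
  have hE0 : 0 ≤ E := mul_nonneg (by positivity) (Finset.sum_nonneg fun a _ => hD0 a)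
  set S : ℝ := ∑ c ∈ G, p c * ν c with hS
  have hsumbad : ∑ a ∈ Gᶜ, D a ≤ N * E := by
    rw [hE, mul_inv_cancel_left₀ hN0.ne']
    exact Finset.sum_le_sum_of_subset_of_nonneg (Finset.subset_univ _) fun a _ _ => hD0 a
  have hcardbad : ((Gᶜ.card : ℕ) : ℝ) * η ^ 2 ≤ N * E := by
    refine le_trans ?_ hsumbad
    have := Finset.card_nsmul_le_sum Gᶜ D (η ^ 2) hbad
    rwa [nsmul_eq_mul] at this
  have hcard : (G.card : ℝ) + Gᶜ.card = N := by
    rw [hN]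
    exact_mod_cast Finset.card_add_card_compl G
  have hNS : |N * S - 1| ≤ 3 * η + E / η ^ 2 := by
    have e1 : |N ^ 2 * S - G.card| ≤ N * (3 * η) := by
      have : N ^ 2 * S - G.card = ∑ c ∈ G, (N ^ 2 * (p c * ν c) - 1) := by
        rw [Finset.sum_sub_distrib, ← Finset.mul_sum, ← hS]
        simp
      rw [this]
      refine (Finset.abs_sum_le_sum_abs _ _).trans ((Finset.sum_le_sum hpν).trans ?_)
      rw [Finset.sum_const, nsmul_eq_mul]
      have : (0 : ℝ) ≤ Gᶜ.card := Nat.cast_nonneg _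
      exact mul_le_mul_of_nonneg_right (by linarith) (by positivity)
    have e2 : (Gᶜ.card : ℝ) ≤ N * (E / η ^ 2) := by
      rw [mul_div_assoc', le_div_iff₀ (by positivity)]
      exact hcardbad
    have e3 : N * |N * S - 1| ≤ N * (3 * η + E / η ^ 2) := by
      have e4 : N * |N * S - 1| = |(N ^ 2 * S - G.card) - Gᶜ.card| := by
        rw [mul_abs_eq_abs_mul hN0]
        congr 1
        rw [← hcard]
        ring
      rw [e4]
      refine (abs_sub _ _).trans ?_
      rw [Nat.abs_cast]
      linarith
    exact le_of_mul_le_mul_left e3 hN0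
  have hS0 : 0 ≤ S := Finset.sum_nonneg fun c _ => mul_nonneg (hp0 c) (hν0 c)
  have hS1 : N * S ≤ 4 := by
    have : S ≤ ∑ c, p c * (2 / N) := by
      refine le_trans (Finset.sum_le_sum fun c hc =>
        mul_le_mul_of_nonneg_left (hcap (hgood c hc).2.1) (hp0 c)) ?_
      exact Finset.sum_le_sum_of_subset_of_nonneg (Finset.subset_univ _) fun c _ _ =>
        mul_nonneg (hp0 c) (by positivity)
    rw [← Finset.sum_mul, hp, one_mul, le_div_iff₀ hN0] at this
    linarith
  -- Since `|N * S - 1| ≤ 3`, one factor of the square is bounded by `3`, keeping the estimate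
  -- linear in `E`.
  have hNS2 : (N * S - 1) ^ 2 ≤ 3 * (3 * η + E / η ^ 2) := by
    have h3 : |N * S - 1| ≤ 3 := by
      rw [abs_le]
      constructor <;> nlinarith
    rw [← sq_abs]
    nlinarith [abs_nonneg (N * S - 1)]
  have hsq : √N ^ 2 = N := Real.sq_sqrt hN0.le
  have hsN : 1 ≤ √N := Real.one_le_sqrt.2 hN1
  have hk1 : L ≤ k := by nlinarith
  have hk2 : L * N ≤ (k : ℝ) ^ 2 := by
    have := pow_le_pow_left₀ (by positivity) hk 2
    rw [mul_pow, hsq] at this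
    have : L * N ≤ L ^ 2 * N := mul_le_mul_of_nonneg_right (by nlinarith) hN0.le
    linarith
  have hk3 : (k : ℝ) ^ 2 ≤ 4 * L ^ 2 * N := by
    have := pow_le_pow_left₀ hk0.le hk' 2
    rw [mul_pow, mul_pow, hsq] at this
    linarith
  have hv1 : 8 / (k : ℝ) ≤ 8 / L := by gcongr
  have hv2 : 2 * N / (k : ℝ) ^ 2 ≤ 2 / L := by
    rw [div_le_div_iff₀ (by positivity) (by positivity)]
    linarith
  have hbadsum : k ^ 2 * ∑ c ∈ Gᶜ, p c * ν c ≤ 12 * L ^ 2 * (E / η ^ 2) := by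
    have h1 : N ^ 2 * ∑ c ∈ Gᶜ, p c * ν c ≤ 3 * (N * E / η ^ 2) := by
      rw [Finset.mul_sum]
      calc ∑ c ∈ Gᶜ, N ^ 2 * (p c * ν c) ≤ ∑ c ∈ Gᶜ, 3 * (D c / η ^ 2) := by
            refine Finset.sum_le_sum fun c hc => ?_
            have := mul_le_three_mul_div (x := N * p c) (y := N * ν c) hη0 hη (hbad c hc)
              (by simp only [hD]; linarith [sq_nonneg ‖(N : ℂ) * X c c - z₀‖])
            linarith
        _ = 3 * ((∑ c ∈ Gᶜ, D c) / η ^ 2) := by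
            rw [← Finset.mul_sum, Finset.sum_div]
        _ ≤ _ := by gcongr
    have h2 : 0 ≤ ∑ c ∈ Gᶜ, p c * ν c :=
      Finset.sum_nonneg fun c _ => mul_nonneg (hp0 c) (hν0 c)
    have h3 : N * ∑ c ∈ Gᶜ, p c * ν c ≤ 3 * (E / η ^ 2) := by
      refine le_of_mul_le_mul_left ?_ hN0
      calc N * (N * ∑ c ∈ Gᶜ, p c * ν c) = N ^ 2 * ∑ c ∈ Gᶜ, p c * ν c := by ring
        _ ≤ 3 * (N * E / η ^ 2) := h1
        _ = N * (3 * (E / η ^ 2)) := by ring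
    calc (k : ℝ) ^ 2 * ∑ c ∈ Gᶜ, p c * ν c ≤ 4 * L ^ 2 * N * ∑ c ∈ Gᶜ, p c * ν c :=
          mul_le_mul_of_nonneg_right hk3 h2
      _ = 4 * L ^ 2 * (N * ∑ c ∈ Gᶜ, p c * ν c) := by ring
      _ ≤ 4 * L ^ 2 * (3 * (E / η ^ 2)) := mul_le_mul_of_nonneg_left h3 (by positivity)
      _ = _ := by ring
  rw [collision_variance_eq hk0.ne' hN0.ne']
  have hEη : 0 ≤ E / η ^ 2 := by positivity
  have hL2 : E / η ^ 2 ≤ L ^ 2 * (E / η ^ 2) := le_mul_of_one_le_left hEη (by nlinarith)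
  -- The constants add up as `33 = 24 + 9`, `10 = 8 + 2` and `15 = 3 + 12`.
  have e1 : 15 * L ^ 2 / η ^ 2 * E = 15 * (L ^ 2 * (E / η ^ 2)) := by ring
  have e2 : 10 / L = 8 / L + 2 / L := by ring
  rw [e1, e2]
  linarith

theorem exists_selection {ι : Type*} {k : ℕ} [NeZero k] :
    ∃ sel : (Fin k → ι) → (Fin k → ι) → Fin k × Fin k,
      ∀ (a b : Fin k → ι) (i j : Fin k), a i = b j → a (sel a b).1 = b (sel a b).2 := by
  classical
  -- Without a collision any pair will do; the default `0` needs `k ≠ 0`.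
  refine ⟨fun a b => if h : ∃ ij : Fin k × Fin k, a ij.1 = b ij.2 then h.choose else 0,
    fun a b i j hij => ?_⟩
  have h : ∃ ij : Fin k × Fin k, a ij.1 = b ij.2 := ⟨(i, j), hij⟩
  simp only [dif_pos h]
  exact h.choose_spec

theorem sum_norm_sq_inputState {d k : ℕ} {ψ φ : EuclideanSpace ℂ (Fin d)} (hψ : ‖ψ‖ = 1)
    (hφ : ‖φ‖ = 1) : ∑ a, ∑ b, ‖inputState k ψ φ a b‖ ^ 2 = 1 := by
  have h : ∀ χ : EuclideanSpace ℂ (Fin d), ‖χ‖ = 1 → ∑ a, ‖tensorPower k χ a‖ ^ 2 = 1 := by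
    intro χ hχ
    have := normSqVec_piTensorVec fun _ : Fin k => ⇑χ
    rw [normSqVec_eq_one hχ, Finset.prod_const_one] at this
    exact this
  simp only [inputState, Matrix.vecMulVec_apply, norm_mul, mul_pow, ← Finset.mul_sum, h φ hφ,
    mul_one, h ψ hψ]

/-! ### Rounds with small bias, and their averages. -/

namespace Protocol

/-- If a full copy can be sent with `t` messages, a single swap test gives an unbiased estimate. -/
theorem exists_round_of_le_pow {d q t : ℕ} (h : d ≤ q ^ t) :
    ∃ P : Protocol q (Fin 1 → Fin d) (Fin 1 → Fin d), P.messages ≤ t ∧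
      ∀ ψ φ : EuclideanSpace ℂ (Fin d),
        P.expect (fun r => r ^ 2) (inputState 1 ψ φ) = P.expect (fun _ => 1) (inputState 1 ψ φ) ∧
        P.expect id (inputState 1 ψ φ) = ‖inner ℂ ψ φ‖ ^ 2 := by
  classical
  obtain ⟨f⟩ : Nonempty (Fin d ↪ (Fin t → Fin q)) :=
    Function.Embedding.nonempty_of_card_le (by simpa using h)
  -- The isometry `J` encodes a full copy in `t` messages; it is the only Kraus operator of a round
  -- without randomness.
  let J : Matrix (Fin t → Fin q) (Fin d) ℂ := Matrix.of fun x y => if x = f y then 1 else 0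
  have hJ : Jᴴ * J = 1 := by
    ext y z
    simp [J, Matrix.mul_apply, Matrix.one_apply, f.injective.eq_iff, eq_comm]
  obtain ⟨P, hP, hP'⟩ := exists_round (q := q) (k := 1) (Equiv.refl (Fin t → Fin q))
    (fun (_ : Unit) (_ : Unit) => J) (fun _ => by simp [hJ]) (fun _ _ => (0, 0))
  refine ⟨P, hP, fun ψ φ => ⟨(hP' ψ φ).1, ?_⟩⟩
  rw [(hP' ψ φ).2, inner_eq_dotProduct, Matrix.star_mulVec, ← Matrix.dotProduct_mulVec,
    Matrix.mulVec_mulVec, hJ, Matrix.one_mulVec]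
  have : IsEmpty {l : Fin 1 // l ≠ 0} := ⟨fun l => l.2 (Subsingleton.elim _ _)⟩
  simp

/-- For large message dimension, a round with `O(√(d / q))` copies and one message gives an
estimate with small bias. -/
theorem exists_round_of_large {ε : ℝ} (hε : 0 < ε) :
    ∃ (C : ℝ) (q₀ : ℕ), 1 ≤ C ∧ ∀ d q : ℕ, 0 < q → q₀ ≤ q → q ≤ d →
      ∃ k : ℕ, (k : ℝ) ≤ C * √((d : ℝ) / q) ∧
        ∃ P : Protocol q (Fin k → Fin d) (Fin k → Fin d), P.messages ≤ 1 ∧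
          ∀ ψ φ : EuclideanSpace ℂ (Fin d), ‖ψ‖ = 1 → ‖φ‖ = 1 →
            P.expect (fun r => r ^ 2) (inputState k ψ φ) =
              P.expect (fun _ => 1) (inputState k ψ φ) ∧
            |P.expect id (inputState k ψ φ) - ‖inner ℂ ψ φ‖ ^ 2| ≤ ε := by
  classical
  -- The three terms of the bias get `ε / 3` each: `η` is fixed first, then `L`, then `q₀` in terms
  -- of both.
  obtain ⟨η, hη0, hη, hηε⟩ : ∃ η : ℝ, 0 < η ∧ η ≤ 1 / 2 ∧ 33 * η ≤ ε / 3 :=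
    ⟨min (1 / 2) (ε / 99), by positivity, min_le_left _ _, by
      have := min_le_right (1 / 2) (ε / 99)
      linarith⟩
  obtain ⟨L, hL, hLε⟩ : ∃ L : ℝ, 1 ≤ L ∧ 10 / L ≤ ε / 3 :=
    ⟨max 1 (30 / ε), le_max_left _ _, by
      have h : 30 / ε ≤ max 1 (30 / ε) := le_max_right _ _
      have h1 : (1 : ℝ) ≤ max 1 (30 / ε) := le_max_left _ _
      rw [div_le_iff₀ hε] at h
      rw [div_le_iff₀ (by linarith)]
      linarith⟩
  obtain ⟨q₀, hq₀⟩ := exists_nat_ge (15 * L ^ 2 / η ^ 2 * 3 * (3 / ε))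
  refine ⟨4 * L, q₀, by linarith, fun d q hq hqq hqd => ?_⟩
  have : NeZero q := ⟨hq.ne'⟩
  -- Rounding up gives `d ≤ N * q`, so the labels embed, while `q ≤ d` keeps `N ≤ 2 * (d / q)`.
  set N : ℕ := d / q + 1 with hN
  have hqR : (0 : ℝ) < q := by exact_mod_cast hq
  have hN1 : (1 : ℝ) ≤ N := by exact_mod_cast Nat.le_add_left 1 (d / q)
  have hNd : (N : ℝ) ≤ 2 * (d / q) := by
    have h1 : ((d / q : ℕ) : ℝ) ≤ d / q := Nat.cast_div_le
    have h2 : (1 : ℝ) ≤ d / q := by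
      rw [le_div_iff₀ hqR, one_mul]
      exact_mod_cast hqd
    rw [hN]
    push_cast
    linarith
  obtain ⟨e⟩ : Nonempty (Fin d ↪ ZMod N × ZMod q) :=
    Function.Embedding.nonempty_of_card_le (by
      rw [Fintype.card_fin, Fintype.card_prod, ZMod.card, ZMod.card]
      exact ((Nat.div_lt_iff_lt_mul hq).1 (Nat.lt_succ_self (d / q))).le)
  have hsN : 1 ≤ √(N : ℝ) := Real.one_le_sqrt.2 hN1
  set k : ℕ := ⌈L * √(N : ℝ)⌉₊ with hk
  have hk1 : L * √(N : ℝ) ≤ k := Nat.le_ceil _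
  have hk2 : k ≤ 2 * L * √(N : ℝ) := by
    have := (Nat.ceil_lt_add_one (show 0 ≤ L * √(N : ℝ) by positivity)).le
    have : 1 ≤ L * √(N : ℝ) := one_le_mul_of_one_le_of_one_le hL hsN
    linarith
  have : NeZero k := ⟨(Nat.ceil_pos.2 (by positivity)).ne'⟩
  obtain ⟨sel, hsel⟩ := exists_selection (ι := ZMod N) (k := k)
  obtain ⟨eX⟩ : Nonempty (ZMod q ≃ (Fin 1 → Fin q)) :=
    ⟨Fintype.equivOfCardEq (by simp [ZMod.card])⟩
  obtain ⟨P, hP, hP'⟩ := exists_round eX (blockKraus e) (sum_blockKraus e.injective) sel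
  refine ⟨k, ?_, P, hP, fun ψ φ hψ hφ => ⟨(hP' ψ φ).1, ?_⟩⟩
  · have h1 : √(N : ℝ) ≤ 2 * √((d : ℝ) / q) := by
      rw [show (2 : ℝ) = √(2 ^ 2) from (Real.sqrt_sq (by norm_num)).symm,
        ← Real.sqrt_mul (by norm_num)]
      refine Real.sqrt_le_sqrt (hNd.trans ?_)
      have : (0 : ℝ) ≤ d / q := by positivity
      linarith
    have := mul_le_mul_of_nonneg_left h1 (show 0 ≤ 2 * L by linarith)
    linarith
  · rw [(hP' ψ φ).2, inner_eq_dotProduct]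
    set Ω := (ZMod N → ZMod q) × (Fin d → ZMod 3)
    set z₀ := star (⇑ψ) ⬝ᵥ ⇑φ
    have hψ1 := normSqVec_eq_one hψ
    have hφ1 := normSqVec_eq_one hφ
    have hz₀ : ‖z₀‖ ≤ 1 := by
      have := norm_star_dotProduct_sq_le (⇑ψ) (⇑φ)
      rw [hψ1, hφ1, one_mul] at this
      exact (sq_le_one_iff₀ (norm_nonneg _)).1 this
    have hcard : (0 : ℝ) < Fintype.card Ω := by exact_mod_cast Fintype.card_pos
    have havg : ∀ x : ℝ, (Fintype.card Ω : ℝ)⁻¹ * ∑ _u : Ω, x = x := by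
      intro x
      rw [Finset.sum_const, Finset.card_univ, nsmul_eq_mul, inv_mul_cancel_left₀ hcard.ne']
    have hbound := fun u : Ω => abs_sum_selected_sub_le_of_deviation
      (p := fun a => normSqVec (blockKraus e u a *ᵥ ψ))
      (ν := fun a => normSqVec (blockKraus e u a *ᵥ φ))
      ((sum_normSqVec_kraus (sum_blockKraus e.injective u) _).trans hψ1)
      ((sum_normSqVec_kraus (sum_blockKraus e.injective u) _).trans hφ1)
      (fun a => normSqVec_nonneg _) (fun a => normSqVec_nonneg _)
      (X := fun a b => star (blockKraus e u a *ᵥ ψ) ⬝ᵥ (blockKraus e u b *ᵥ φ))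
      (fun a b => norm_star_dotProduct_sq_le _ _) hz₀ hη0 hη hL
      (by rw [ZMod.card]; exact hk1) (by rw [ZMod.card]; exact hk2) sel hsel
    simp only [ZMod.card] at hbound
    -- A deviation of outcome weights is an overlap deviation of a state with itself, so one
    -- second-moment bound serves all three terms.
    have hself : ∀ {χ : Fin d → ℂ}, normSqVec χ = 1 → ∀ (u : Ω) (a : ZMod N),
        ((N : ℝ) * normSqVec (blockKraus e u a *ᵥ χ) - 1) ^ 2 =
        ‖(N : ℂ) * (star (blockKraus e u a *ᵥ χ) ⬝ᵥ (blockKraus e u a *ᵥ χ))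
          - star χ ⬝ᵥ χ‖ ^ 2 := by
      intro χ hχ u a
      rw [star_dotProduct_self, star_dotProduct_self, hχ]
      rw [show (N : ℂ) * (normSqVec (blockKraus e u a *ᵥ χ) : ℂ) - ((1 : ℝ) : ℂ) =
        (((N : ℝ) * normSqVec (blockKraus e u a *ᵥ χ) - 1 : ℝ) : ℂ) by push_cast; rfl]
      rw [Complex.norm_real, Real.norm_eq_abs, sq_abs]
    simp only [hself hψ1, hself hφ1] at hbound
    set dev : (Fin d → ℂ) → (Fin d → ℂ) → Ω → ZMod N → ℝ := fun α β u a =>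
      ‖(N : ℂ) * (star (blockKraus e u a *ᵥ α) ⬝ᵥ (blockKraus e u a *ᵥ β))
          - star α ⬝ᵥ β‖ ^ 2 with hdev
    have hmom : ∀ α β : Fin d → ℂ, normSqVec α = 1 → normSqVec β = 1 →
        (Fintype.card Ω : ℝ)⁻¹ * ∑ u, ((N : ℝ)⁻¹ * ∑ a, dev α β u a) ≤ (q : ℝ)⁻¹ := by
      intro α β hα hβ
      rw [← Finset.mul_sum, mul_left_comm, Finset.sum_comm, Finset.mul_sum]
      have h1 : ∑ a : ZMod N, (Fintype.card Ω : ℝ)⁻¹ * ∑ u, dev α β u a ≤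
          ∑ _a : ZMod N, (q : ℝ)⁻¹ :=
        Finset.sum_le_sum fun a _ => sum_norm_sq_blockKraus_overlap_sub_le e.injective a hα hβ
      rw [Finset.sum_const, Finset.card_univ, ZMod.card, nsmul_eq_mul] at h1
      rwa [inv_mul_le_iff₀ (by linarith)]
    have hmom3 : (Fintype.card Ω : ℝ)⁻¹ * ∑ u, ((N : ℝ)⁻¹ *
        ∑ a, (dev ψ ψ u a + dev φ φ u a + dev ψ φ u a)) ≤ 3 * (q : ℝ)⁻¹ := by
      have h1 := hmom _ _ hψ1 hψ1
      have h2 := hmom _ _ hφ1 hφ1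
      have h3 := hmom _ _ hψ1 hφ1
      simp only [Finset.sum_add_distrib, mul_add]
      linarith
    have hfin : 15 * L ^ 2 / η ^ 2 * (3 * (q : ℝ)⁻¹) ≤ ε / 3 := by
      have h1 : 15 * L ^ 2 / η ^ 2 * 3 * (3 / ε) ≤ q := hq₀.trans (by exact_mod_cast hqq)
      rw [← mul_assoc, ← div_eq_mul_inv, div_le_iff₀ hqR]
      have h2 := mul_le_mul_of_nonneg_left h1 (show 0 ≤ ε / 3 by positivity)
      have h3 : ε / 3 * (15 * L ^ 2 / η ^ 2 * 3 * (3 / ε)) = 15 * L ^ 2 / η ^ 2 * 3 := by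
        field_simp
      linarith
    rw [← havg (‖z₀‖ ^ 2), ← mul_sub, ← Finset.sum_sub_distrib, abs_mul,
      abs_of_pos (inv_pos.2 hcard)]
    refine (mul_le_mul_of_nonneg_left ((Finset.abs_sum_le_sum_abs _ _).trans
      (Finset.sum_le_sum fun u _ => hbound u)) (inv_pos.2 hcard).le).trans ?_
    rw [Finset.sum_add_distrib, mul_add, havg, ← Finset.mul_sum, mul_left_comm]
    have := mul_le_mul_of_nonneg_left hmom3 (show 0 ≤ 15 * L ^ 2 / η ^ 2 by positivity)
    change _ + 15 * L ^ 2 / η ^ 2 * ((Fintype.card Ω : ℝ)⁻¹ * ∑ u, ((N : ℝ)⁻¹ *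
        ∑ a, (dev ψ ψ u a + dev φ φ u a + dev ψ φ u a))) ≤ ε
    linarith

/-- Averaging independent repetitions of a round with bounded outcome and small bias. -/
theorem exists_average {q d k : ℕ} [NeZero q] (P : Protocol q (Fin k → Fin d) (Fin k → Fin d))
    {n : ℕ} (hn : 0 < n) :
    ∃ Q : Protocol q (Fin (n * k) → Fin d) (Fin (n * k) → Fin d),
      Q.messages ≤ n * P.messages ∧
      ∀ (ψ φ : EuclideanSpace ℂ (Fin d)) (ε b F : ℝ), ‖ψ‖ = 1 → ‖φ‖ = 1 → 0 < ε →
        P.expect (fun r => r ^ 2) (inputState k ψ φ) =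
          P.expect (fun _ => 1) (inputState k ψ φ) →
        |P.expect id (inputState k ψ φ) - F| ≤ b →
        1 - (b ^ 2 + 1 / n) / ε ^ 2 ≤ Q.prob {r : ℝ | |r - F| ≤ ε} (inputState (n * k) ψ φ) := by
  have hnR : (0 : ℝ) < n := by exact_mod_cast hn
  obtain ⟨Q₀, h₀, h₀'⟩ := exists_repeat P (fun r => r / n) n 0
  -- The `n * k` copies are split into `n` groups of `k`, one per round.
  let E : (Fin (n * k) → Fin d) ≃ (Fin n → Fin k → Fin d) :=
    (Equiv.arrowCongr finProdFinEquiv.symm (Equiv.refl _)).trans (Equiv.curry _ _ _)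
  obtain ⟨Q, hQ, hQ'⟩ := exists_relabel E E Q₀
  refine ⟨Q, hQ.trans_le h₀, fun ψ φ ε b F hψ hφ hε h2 hb => ?_⟩
  have hone : P.expect (fun _ => 1) (inputState k ψ φ) = 1 := by
    rw [expect_const, sum_norm_sq_inputState hψ hφ, one_mul]
  have hin : (inputState (n * k) ψ φ).submatrix E.symm E.symm =
      Matrix.of fun (x y : Fin n → Fin k → Fin d) => ∏ i, inputState k ψ φ (x i) (y i) := by
    ext x y
    simp only [inputState, Matrix.submatrix_apply, Matrix.vecMulVec_apply, Matrix.of_apply,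
      tensorPower, Finset.prod_mul_distrib, ← Fintype.prod_prod_type']
    rw [← finProdFinEquiv.prod_comp, ← finProdFinEquiv.prod_comp]
    simp [E, Function.uncurry]
  set μ := P.expect id (inputState k ψ φ)
  have hvar : Q.expect (fun r => (n * r - n * F) ^ 2) (inputState (n * k) ψ φ) =
      (n * μ - n * F) ^ 2 + n * (1 - μ ^ 2) := by
    rw [hQ', hin, h₀' _ _ (n * F) (fun r => by field_simp) hone, h2, hone, zero_add]
  -- Chebyshev's inequality in pointwise form: the indicator is at least `1 - (r - F) ^ 2 / ε ^ 2`.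
  have hlow : ∀ r : ℝ, 1 + (-1 / (n ^ 2 * ε ^ 2)) * (n * r - n * F) ^ 2 ≤
      ({r : ℝ | |r - F| ≤ ε} : Set ℝ).indicator 1 r := by
    intro r
    have e1 : (-1 / ((n : ℝ) ^ 2 * ε ^ 2)) * (n * r - n * F) ^ 2 = -((r - F) ^ 2 / ε ^ 2) := by
      field_simp
    rw [e1, Set.indicator_apply]
    split_ifs with hr
    · have : 0 ≤ (r - F) ^ 2 / ε ^ 2 := by positivity
      simp only [Pi.one_apply]
      linarith
    · simp only [Set.mem_ofPred_eq, not_le] at hr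
      have := pow_le_pow_left₀ hε.le hr.le 2
      rw [sq_abs] at this
      have : 1 ≤ (r - F) ^ 2 / ε ^ 2 := by rwa [le_div_iff₀ (by positivity), one_mul]
      linarith
  rw [prob_eq_expect]
  refine le_trans ?_ (expect_mono Q hlow _)
  rw [expect_add, expect_const_mul, expect_const, sum_norm_sq_inputState hψ hφ, hvar]
  have hb2 : (μ - F) ^ 2 ≤ b ^ 2 := by
    rw [← sq_abs]
    exact pow_le_pow_left₀ (abs_nonneg _) hb 2
  have e2 : (1 : ℝ) * 1 + -1 / (n ^ 2 * ε ^ 2) * ((n * μ - n * F) ^ 2 + n * (1 - μ ^ 2)) =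
      1 - ((μ - F) ^ 2 + (1 - μ ^ 2) / n) / ε ^ 2 := by
    field_simp
    ring
  rw [e2]
  have : (1 - μ ^ 2) / n ≤ 1 / n := by
    gcongr
    linarith [sq_nonneg μ]
  gcongr

end Protocol

theorem mainTheorem2 (ε δ c : ℝ) (hε : 0 < ε) (hδ : 0 < δ) (hc : 0 < c) :
    ∃ (C : ℝ) (m : ℕ), 0 < C ∧
      ∀ d q : ℕ, 2 ≤ q → q ≤ d → c * Real.log d ≤ q →
        ∃ k : ℕ, (k : ℝ) ≤ C * √((d : ℝ) / q) ∧
          ∃ P : Protocol q (Fin k → Fin d) (Fin k → Fin d),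
            P.messages ≤ m ∧
            ∀ ψ φ : EuclideanSpace ℂ (Fin d), ‖ψ‖ = 1 → ‖φ‖ = 1 →
              1 - δ ≤ P.prob {r : ℝ | |r - ‖inner ℂ ψ φ‖ ^ 2| ≤ ε} (inputState k ψ φ) := by
  -- The squared bias and the variance `1 / n` each receive half of the Chebyshev budget `δ * ε ^
  -- 2`.
  set b : ℝ := √(δ * ε ^ 2 / 2) with hb
  have hb2 : b ^ 2 = δ * ε ^ 2 / 2 := Real.sq_sqrt (by positivity)
  have hb0 : 0 < b := Real.sqrt_pos.2 (by positivity)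
  obtain ⟨n, hn⟩ := exists_nat_gt (2 / (δ * ε ^ 2))
  have hnR : (0 : ℝ) < n := lt_trans (by positivity) hn
  have hn0 : 0 < n := by exact_mod_cast hnR
  have hbn : (b ^ 2 + 1 / n) / ε ^ 2 ≤ δ := by
    have h1 : 1 / (n : ℝ) ≤ δ * ε ^ 2 / 2 := by
      rw [div_lt_iff₀ (by positivity)] at hn
      rw [div_le_iff₀ hnR]
      linarith
    rw [div_le_iff₀ (by positivity), hb2]
    linarith
  obtain ⟨C, q₀, hC, hlarge⟩ := Protocol.exists_round_of_large hb0
  -- When `q < q₀`, the logarithmic hypothesis gives `d ≤ exp (q₀ / c) < t < q ^ t`. The bound `t +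
  -- 1` per round covers both this case and the single message needed when `q₀ ≤ q`.
  obtain ⟨t, ht⟩ := exists_nat_gt (Real.exp (q₀ / c))
  refine ⟨n * C, n * (t + 1), by positivity, fun d q hq hqd hlog => ?_⟩
  have : NeZero q := ⟨by omega⟩
  have hqR : (0 : ℝ) < q := by exact_mod_cast (show 0 < q by omega)
  have hround : ∃ k : ℕ, (k : ℝ) ≤ C * √((d : ℝ) / q) ∧
      ∃ P : Protocol q (Fin k → Fin d) (Fin k → Fin d), P.messages ≤ t + 1 ∧
        ∀ ψ φ : EuclideanSpace ℂ (Fin d), ‖ψ‖ = 1 → ‖φ‖ = 1 →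
          P.expect (fun r => r ^ 2) (inputState k ψ φ) =
            P.expect (fun _ => 1) (inputState k ψ φ) ∧
          |P.expect id (inputState k ψ φ) - ‖inner ℂ ψ φ‖ ^ 2| ≤ b := by
    by_cases hqq : q₀ ≤ q
    · obtain ⟨k, hk, P, hP, hP'⟩ := hlarge d q (by omega) hqq hqd
      exact ⟨k, hk, P, by omega, hP'⟩
    · have hd : (d : ℝ) ≤ Real.exp (q₀ / c) := by
        rw [← Real.log_le_iff_le_exp (by exact_mod_cast (show 0 < d by omega)),
          le_div_iff₀' hc]
        exact hlog.trans (by exact_mod_cast (not_le.1 hqq).le)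
      have hdt : d ≤ q ^ t := by
        have h1 : d ≤ t := by exact_mod_cast hd.trans ht.le
        exact h1.trans ((Nat.lt_pow_self (by omega)).le)
      obtain ⟨P, hP, hP'⟩ := Protocol.exists_round_of_le_pow hdt
      refine ⟨1, ?_, P, by omega, fun ψ φ _ _ => ⟨(hP' ψ φ).1, ?_⟩⟩
      · have : 1 ≤ √((d : ℝ) / q) := by
          rw [Real.one_le_sqrt, le_div_iff₀ hqR, one_mul]
          exact_mod_cast hqd
        push_cast
        exact one_le_mul_of_one_le_of_one_le hC this
      · rw [(hP' ψ φ).2, sub_self, abs_zero]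
        exact hb0.le
  obtain ⟨k, hk, P, hP, hP'⟩ := hround
  obtain ⟨Q, hQ, hQ'⟩ := Protocol.exists_average P hn0
  refine ⟨n * k, ?_, Q, hQ.trans (Nat.mul_le_mul_left n hP), fun ψ φ hψ hφ => ?_⟩
  · push_cast
    rw [mul_assoc]
    exact mul_le_mul_of_nonneg_left hk hnR.le
  · obtain ⟨h2, h1⟩ := hP' ψ φ hψ hφ
    refine le_trans ?_ (hQ' ψ φ ε b _ hψ hφ hε h2 h1)
    linarith
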